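/- **Theorem (Scaling limit).** For $n\ge 1$ let the $n$-detachment process be the following time-inhomogeneous Markov process: at time $1$ all $n$ passengers sit in bus $1$; at each time $k\ge 2$ a new bus, labelled $k$, becomes available, and each passenger independently relocates to bus $k$ with probability $1/k$ and otherwise stays in her current bus. Let $L_k$ be the number of lonely passengers at time $k$, i.e. of passengers who share their bus with no other passenger, and put $L_s:=L_{\lfloor s\rfloor}$ for real $s\ge 1$ and $L_s:=L_1$ for $0<s<1$. The process is in a state of detachment at time $s$ if $L_s=n$. Define the $\{0,1\}$-valued process $X^{(n)}$ on $(0,\infty)$ by $$X^{(n)}_t:=\mathbf 1(L_{tn^2}=n),\qquad t>0.$$ The paths of $X^{(n)}$ are càdlàg on $(0,\infty)$ (right-continuous, with finite left limits, at every $t>0$). As $n\to\infty$, the processes $X^{(n)}$ converge in the sense of finite-dimensional distributions to a $\{0,1\}$-valued process $X=(X_t)_{t>0}$ with càdlàg paths: for all $t_1,\dots,t_m>0$, $(X^{(n)}_{t_1},\dots,X^{(n)}_{t_m})\to(X_{t_1},\dots,X_{t_m})$ in distribution. In particular this holds on $[1,\infty)$. Moreover, for all $c>0$, $$P(X_c=1)=e^{-1/(2c)},$$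 and, for all $0<c<d$, $$P(X_d=1\mid X_c=1)=\lim_{n\to\infty}P(X^{(n)}_d=1\mid X^{(n)}_c=1)=\exp\left(-\frac{d-c}{2d^2}\right),$$ $$P(X_d=1\mid X_c=0)=\lim_{n\to\infty}P(X^{(n)}_d=1\mid X^{(n)}_c=0)=\frac{\exp\left(-\frac1{2d}\right)-\exp\left(-\frac1{2c}-\frac{d-c}{2d^2}\right)}{1-\exp\left(-\frac1{2c}\right)}.$$ -/

import Mathlib

open MeasureTheory ProbabilityTheory Filter Topology

universe u

/-- `B k ω i` is the label of the bus in which passenger `i` sits at time `k ≥ 1`.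

`B` is the (passenger-labelled) `n`-detachment process under `P`: at time `1` everybody sits in
bus `1`, and at each time `k ≥ 2` every passenger, independently of everything else, relocates to
the new bus `k` with probability `1 / k` and otherwise stays where she is. (The index `k = 0`
plays no role.) The relocation times `k ≥ 2` are written as `k + 2` with `k : ℕ`. Since bus
`k + 2` is unused before time `k + 2`, the event `{B (k + 2) i = k + 2}` is exactly the event
that passenger `i` relocates at time `k + 2`. -/
structure IsDetachmentProcess {Ω : Type*} [MeasurableSpace Ω] (P : Measure Ω) (n : ℕ)
    (B : ℕ → Ω → Fin n → ℕ) : Prop where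
  measurable : ∀ k, 1 ≤ k → Measurable (B k)
  start : ∀ ω i, B 1 ω i = 1
  step : ∀ k ω i, B (k + 2) ω i = k + 2 ∨ B (k + 2) ω i = B (k + 1) ω i
  prob : ∀ (k : ℕ) (i : Fin n), P {ω | B (k + 2) ω i = k + 2} = ENNReal.ofReal (1 / ((k : ℝ) + 2))
  indep : iIndepSet (fun p : ℕ × Fin n => {ω | B (p.1 + 2) ω p.2 = p.1 + 2}) P

/-- The number of lonely passengers in a configuration `b`: those who share their bus with no
other passenger. -/
def lonelyCount {n : ℕ} (b : Fin n → ℕ) : ℕ :=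
  (Finset.univ.filter fun i => ∀ j, j ≠ i → b j ≠ b i).card

/-- The extension of a process from times `1, 2, 3, …` to real times: at time `s ≥ 1` the state is
that of time `⌊s⌋`; for `s < 1` it is that of time `1`. -/
noncomputable def atRealTime {S : Type*} (B : ℕ → S) (s : ℝ) : S :=
  B (max 1 ⌊s⌋₊)

/-- `detachmentIndicator B t ω` is `1` if, at time `t * n ^ 2`, all `n` passengers are lonely
(the process is in a state of detachment), and `0` otherwise. -/
noncomputable def detachmentIndicator {Ω : Type*} {n : ℕ} (B : ℕ → Ω → Fin n → ℕ)
    (t : ℝ) (ω : Ω) : ℝ :=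
  if lonelyCount (atRealTime B (t * (n : ℝ) ^ 2) ω) = n then 1 else 0

/-- A function is càdlàg on `(0, ∞)`: right-continuous with finite left limits at every `t > 0`. -/
def IsCadlagOnPos (f : ℝ → ℝ) : Prop :=
  ∀ t, 0 < t → ContinuousWithinAt f (Set.Ici t) t ∧ ∃ l : ℝ, Tendsto f (𝓝[<] t) (𝓝 l)

/-- The `n`-detachment process exists. -/
theorem exists_isDetachmentProcess (n : ℕ) :
    ∃ (Ω : Type) (_ : MeasurableSpace Ω) (P : Measure Ω) (B : ℕ → Ω → Fin n → ℕ),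
      IsProbabilityMeasure P ∧ IsDetachmentProcess P n B := by
  classical
  have hI : ∀ k : ℕ, (1 / ((k : ℝ) + 2)) ∈ Set.Icc (0 : ℝ) 1 := fun k => by
    refine ⟨by positivity, ?_⟩
    rw [div_le_one (by positivity)]
    have : (0 : ℝ) ≤ k := by positivity
    linarith
  let p : ℕ → unitInterval := fun k => ⟨1 / ((k : ℝ) + 2), hI k⟩
  let μ : ℕ × Fin n → Measure Bool := fun q => bernoulliMeasure true false (p q.1)
  let B : ℕ → (ℕ × Fin n → Bool) → Fin n → ℕ := fun k ω i =>
    Nat.rec 1 (fun m b => Nat.casesOn m 1 fun k => if ω (k, i) then k + 2 else b) k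
  have hB1 : ∀ ω i, B 1 ω i = 1 := fun ω i => rfl
  have hB2 : ∀ k ω i, B (k + 2) ω i = if ω (k, i) then k + 2 else B (k + 1) ω i :=
    fun k ω i => rfl
  have hle : ∀ k ω i, B (k + 1) ω i ≤ k + 1 := by
    intro k ω i
    induction k with
    | zero => simp [hB1]
    | succ k ih => rw [hB2]; split_ifs <;> omega
  have hset : ∀ k i, {ω | B (k + 2) ω i = k + 2} = (fun ω => ω (k, i)) ⁻¹' {true} := by
    intro k i
    ext ω
    have := hle k ω i
    simp only [Set.mem_ofPred_eq, Set.mem_preimage, Set.mem_singleton_iff, hB2]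
    by_cases h : ω (k, i) = true
    · simp [h]
    · simp only [h]
      simp
      omega
  have hmeasset : ∀ q : ℕ × Fin n, MeasurableSet {ω | B (q.1 + 2) ω q.2 = q.1 + 2} := by
    intro q
    rw [hset]
    exact measurable_pi_apply _ (MeasurableSet.singleton _)
  have hprob : ∀ q : ℕ × Fin n, (Measure.infinitePi μ) {ω | B (q.1 + 2) ω q.2 = q.1 + 2}
      = μ q {true} := by
    intro q
    rw [hset]
    exact (measurePreserving_eval_infinitePi μ q).measure_preimage
      (MeasurableSet.singleton _).nullMeasurableSet
  refine ⟨ℕ × Fin n → Bool, inferInstance, Measure.infinitePi μ, B, inferInstance,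
    ?_, hB1, ?_, ?_, ?_⟩
  · intro k hk
    rw [measurable_pi_iff]
    intro i
    obtain ⟨k, rfl⟩ : ∃ m, k = m + 1 := ⟨k - 1, by omega⟩
    induction k with
    | zero => simp only [zero_add, hB1]; exact measurable_const
    | succ k ih =>
      simp only [hB2]
      have h : MeasurableSet ((fun ω : ℕ × Fin n → Bool => ω (k, i)) ⁻¹' {true}) :=
        measurable_pi_apply _ (MeasurableSet.singleton true)
      exact Measurable.ite h measurable_const (ih (by omega))
  · intro k ω i
    rw [hB2]
    split_ifs <;> simp
  · intro k i
    rw [hprob (k, i)]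
    simp only [μ]
    rw [bernoulliMeasure_apply_of_mem_of_notMem _ (MeasurableSet.singleton _) (by simp) (by simp)]
    simp only [p, ENNReal.ofReal]
    congr 1
    ext
    rw [Real.coe_toNNReal _ (hI k).1]
    rfl
  · rw [iIndepSet_iff_meas_biInter hmeasset]
    intro s
    simp only [hprob]
    rw [← Measure.infinitePi_pi μ (s := s) (t := fun _ => {true})
      (fun _ _ => MeasurableSet.singleton _)]
    congr 1
    ext ω
    simp [hset, Set.mem_pi]

/-!
Passengers are all lonely precisely if the bus assignment is injective. Fix times `k < l` and
consider the last relocation of each passenger in `(k, l]`. These are independent of the past up to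
`k` and of each other, uniform on `(k, l]` with total mass `(l - k) / l`, and absent with
probability `k / l`. If the process is in a state of detachment at time `k`, it is so at time `l`
precisely if the passengers that have relocated did so last at distinct times. Hence the states of
detachment are regeneration events (`IsDetachmentProcess.real_inter_injective`): the probability of
being detached at all of finitely many times is a product of transition probabilities
`detachmentTransition n k l`. The choice `k = 0` covers the first of these times, since everybody
may be regarded as relocating to bus `1` at time `1`.

The transition probability is the average of the birthday probability "`m` uniform points of an
`(l - k)`-element set are distinct" over a binomial number `m` of relocated passengers. For
`k ∼ c n²` and `l ∼ d n²`, the birthday probability is uniformly close to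
`exp (- (m / n)² / (2 (d - c)))`, and convergence of Bernstein polynomials evaluates the average at
`m / n = (d - c) / d`, which gives the limit `exp (- (d - c) / (2 d²))`
(`tendsto_detachmentTransition`).

For the limit process, let the points `(w, v)` form a Poisson process with Lebesgue intensity on
`(0, ∞) × (0, 1]`, and let each point stand for two passengers sharing a bus during the time
interval `[v / w, 1 / w)`; the limit process is `1` at the times that no interval contains. Only
finitely many intervals meet `[ε, ∞)`, so its paths are càdlàg. The points whose interval contains
`d` but no earlier time of a finite set with maximum `c` fill the triangle
`{0 < w < 1 / d, c w < v ≤ d w}` of area `(d - c) / (2 d²)`, so the probability of being `1` at all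
of finitely many times obeys the same product formula (`real_limitDetachedAt_insert`). For
`{0, 1}`-valued vectors, convergence of these probabilities is convergence in distribution, and
the conditional probabilities are quotients of such probabilities.
-/

/-! ### The asymptotics of the transition probability between states of detachment -/

/-- The probability that `n` passengers, in a state of detachment at time `k`, are again in a state
of detachment at time `l ≥ k`: the summand `m` is the probability that exactly `m` passengers
relocate after time `k` and that they end up in distinct buses among `k + 1, …, l`. With `k = 0` it
is the probability of a state of detachment at time `l`. -/
noncomputable def detachmentTransition (n k l : ℕ) : ℝ :=
  ∑ m ∈ Finset.range (n + 1),
    (n.choose m : ℝ) * ((k : ℝ) / l) ^ (n - m) * (((l - k).descFactorial m : ℕ) / (l : ℝ) ^ m)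

theorem abs_exp_neg_sub_exp_neg_le {a b : ℝ} (ha : 0 ≤ a) (hb : 0 ≤ b) :
    |Real.exp (-a) - Real.exp (-b)| ≤ |a - b| := by
  wlog hab : a ≤ b generalizing a b
  · rw [abs_sub_comm, abs_sub_comm a b]
    exact this hb ha (le_of_not_ge hab)
  have h1 : Real.exp (-b) ≤ Real.exp (-a) := Real.exp_le_exp.mpr (by linarith)
  have h2 : Real.exp (-a) ≤ 1 := Real.exp_le_one_iff.mpr (by linarith)
  have h3 : a - b + 1 ≤ Real.exp (a - b) := Real.add_one_le_exp _
  have h4 : Real.exp (-b) = Real.exp (-a) * Real.exp (a - b) := by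
    rw [← Real.exp_add]; ring_nf
  have h5 := Real.exp_pos (-a)
  rw [abs_of_nonneg (by linarith), abs_of_nonpos (by linarith), h4]
  nlinarith

/-- The birthday problem: `m` independent uniform points of an `N`-element set are distinct with
probability `∏ i < m, (1 - i / N)`, which is close to `∏ i < m, exp (- i / N)`. -/
theorem abs_birthday_sub_exp_le {n N : ℕ} (hN : 0 < N) (hn : n ≤ N) {m : ℕ} (hm : m ≤ n) :
    |((N.descFactorial m : ℕ) : ℝ) / (N : ℝ) ^ m
      - Real.exp (-((m : ℝ) * (m - 1) / (2 * N)))| ≤ m * ((n : ℝ) / N) ^ 2 := by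
  have hN' : (0 : ℝ) < N := by exact_mod_cast hN
  induction m with
  | zero => simp
  | succ m ih =>
    have ih := ih (by omega)
    set β := ((N.descFactorial m : ℕ) : ℝ) / (N : ℝ) ^ m
    set γ := Real.exp (-((m : ℝ) * (m - 1) / (2 * N))) with hγ
    set x : ℝ := (m : ℝ) / N with hx
    have hmn : (m : ℝ) ≤ n := by exact_mod_cast (by omega : m ≤ n)
    have hnN : (n : ℝ) ≤ N := by exact_mod_cast hn
    have hx0 : 0 ≤ x := by positivity
    have hxn : x ≤ (n : ℝ) / N := by rw [hx]; gcongr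
    have hx1 : x ≤ 1 := hxn.trans ((div_le_one hN').mpr hnN)
    have e1 : ((N.descFactorial (m + 1) : ℕ) : ℝ) / (N : ℝ) ^ (m + 1) = β * (1 - x) := by
      rw [Nat.descFactorial_succ, Nat.cast_mul, Nat.cast_sub (by omega)]
      simp only [β, hx]
      field_simp
      ring
    have e2 : Real.exp (-(((m + 1 : ℕ) : ℝ) * ((m + 1 : ℕ) - 1) / (2 * N)))
        = γ * Real.exp (-x) := by
      rw [hγ, ← Real.exp_add, hx]
      congr 1
      push_cast
      field_simp
      ring
    have hγ1 : γ ≤ 1 := by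
      rw [hγ, Real.exp_le_one_iff, neg_nonpos]
      rcases m with _ | m
      · simp
      · push_cast
        rw [add_sub_cancel_right]
        positivity
    have hγ0 : 0 < γ := Real.exp_pos _
    have h3 := Real.abs_exp_sub_one_sub_id_le (x := -x) (by rwa [abs_neg, abs_of_nonneg hx0])
    rw [neg_sq] at h3
    have h4 : x ^ 2 ≤ ((n : ℝ) / N) ^ 2 := by gcongr
    rw [e1, e2]
    calc |β * (1 - x) - γ * Real.exp (-x)|
        = |(β - γ) * (1 - x) + γ * (-(Real.exp (-x) - 1 - -x))| := by congr 1; ring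
      _ ≤ |β - γ| * (1 - x) + γ * |Real.exp (-x) - 1 - -x| := by
          refine (abs_add_le _ _).trans (le_of_eq ?_)
          rw [abs_mul, abs_mul, abs_neg, abs_of_nonneg (by linarith : 0 ≤ 1 - x),
            abs_of_pos hγ0]
      _ ≤ |β - γ| * 1 + 1 * x ^ 2 := by
          gcongr
          linarith
      _ ≤ ((m + 1 : ℕ) : ℝ) * ((n : ℝ) / N) ^ 2 := by push_cast; linarith

/-- The limit, as a function of the fraction `x` of passengers that have relocated, of the
probability that these are in distinct buses. -/
noncomputable def noCollisionLimit (e : ℝ) : C(unitInterval, ℝ) where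
  toFun x := Real.exp (-((x : ℝ) ^ 2 / (2 * e)))
  continuous_toFun := by fun_prop

theorem abs_birthday_sub_noCollisionLimit_le {n N : ℕ} (hn0 : 0 < n) (hn : n ≤ N) {e : ℝ}
    (he : 0 < e) {m : ℕ} (hm : m ≤ n) :
    |((N.descFactorial m : ℕ) : ℝ) / (N : ℝ) ^ m
      - Real.exp (-(((m : ℝ) / n) ^ 2 / (2 * e)))| ≤
      ((n : ℝ) ^ 2 / N) ^ 2 / n + |(n : ℝ) ^ 2 / N / 2 - 1 / (2 * e)|
        + (n : ℝ) ^ 2 / N / (2 * n) := by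
  have hn' : (0 : ℝ) < n := by exact_mod_cast hn0
  have hN' : (0 : ℝ) < N := by exact_mod_cast hn0.trans_le hn
  have hmn : (m : ℝ) ≤ n := by exact_mod_cast hm
  have hm0 : (0 : ℝ) ≤ m := by positivity
  have h1 := abs_birthday_sub_exp_le (hn0.trans_le hn) hn hm
  have ha : 0 ≤ (m : ℝ) * (m - 1) / (2 * N) := by
    rcases m with _ | m
    · simp
    · push_cast
      rw [add_sub_cancel_right]
      positivity
  have h2 := abs_exp_neg_sub_exp_neg_le ha
    (by positivity : 0 ≤ ((m : ℝ) / n) ^ 2 / (2 * e))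
  have h3 : |(m : ℝ) * (m - 1) / (2 * N) - ((m : ℝ) / n) ^ 2 / (2 * e)| ≤
      |(n : ℝ) ^ 2 / N / 2 - 1 / (2 * e)| + (n : ℝ) ^ 2 / N / (2 * n) := by
    have hq : ((m : ℝ) / n) ^ 2 ≤ 1 := by
      apply pow_le_one₀ (by positivity)
      exact (div_le_one hn').mpr hmn
    have : (m : ℝ) * (m - 1) / (2 * N) - ((m : ℝ) / n) ^ 2 / (2 * e)
        = ((m : ℝ) / n) ^ 2 * ((n : ℝ) ^ 2 / N / 2 - 1 / (2 * e)) + -((m : ℝ) / (2 * N)) := by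
      field_simp
      ring
    rw [this]
    refine (abs_add_le _ _).trans (add_le_add ?_ ?_)
    · rw [abs_mul, abs_of_nonneg (by positivity : 0 ≤ ((m : ℝ) / n) ^ 2)]
      exact mul_le_of_le_one_left (abs_nonneg _) hq
    · rw [abs_neg, abs_of_nonneg (by positivity)]
      have : (n : ℝ) ^ 2 / N / (2 * n) = n / (2 * N) := by field_simp
      rw [this]
      gcongr
  have h4 : (m : ℝ) * ((n : ℝ) / N) ^ 2 ≤ ((n : ℝ) ^ 2 / N) ^ 2 / n := by
    have : ((n : ℝ) ^ 2 / N) ^ 2 / n = n * ((n : ℝ) / N) ^ 2 := by field_simp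
    rw [this]
    gcongr
  refine (abs_sub_le _ (Real.exp (-((m : ℝ) * (m - 1) / (2 * N)))) _).trans ?_
  linarith

/-- The number of passengers that relocate between the times `k` and `l` is binomial with success
probability `(l - k) / l`, so the transition probability is a Bernstein average of birthday
probabilities. -/
theorem detachmentTransition_eq_sum_bernstein {n k l : ℕ} (hkl : k < l) (x : unitInterval)
    (hx : (x : ℝ) = ((l : ℝ) - k) / l) :
    detachmentTransition n k l = ∑ m : Fin (n + 1), bernstein n m x *
      (((l - k).descFactorial m : ℕ) / ((l - k : ℕ) : ℝ) ^ (m : ℕ)) := by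
  have hl : (0 : ℝ) < l := by exact_mod_cast (Nat.zero_le k).trans_lt hkl
  have hlk : (0 : ℝ) < (l : ℝ) - k := sub_pos.mpr (by exact_mod_cast hkl)
  rw [detachmentTransition, Finset.sum_range]
  refine Finset.sum_congr rfl fun m _ => ?_
  have h1 : (1 : ℝ) - ((l : ℝ) - k) / l = k / l := by field_simp; ring
  rw [bernstein_apply, hx, h1, Nat.cast_sub hkl.le, div_pow ((l : ℝ) - k)]
  field_simp

/-- On the time scale `n²` about `n (d - c) / d` passengers relocate between the times `c` and `d`,
and they choose among about `(d - c) n²` buses. -/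
theorem tendsto_detachmentTransition {k l : ℕ → ℕ} {c d : ℝ} (hc : 0 ≤ c) (hcd : c < d)
    (hk : Tendsto (fun n : ℕ => (k n : ℝ) / (n : ℝ) ^ 2) atTop (𝓝 c))
    (hl : Tendsto (fun n : ℕ => (l n : ℝ) / (n : ℝ) ^ 2) atTop (𝓝 d)) :
    Tendsto (fun n => detachmentTransition n (k n) (l n)) atTop
      (𝓝 (Real.exp (-((d - c) / (2 * d ^ 2))))) := by
  have hd : 0 < d := hc.trans_lt hcd
  have he : 0 < d - c := sub_pos.mpr hcd
  have hpos : ∀ᶠ n : ℕ in atTop, 0 < n := eventually_gt_atTop 0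
  have hNlim : Tendsto (fun n : ℕ => ((l n : ℝ) - k n) / (n : ℝ) ^ 2) atTop (𝓝 (d - c)) := by
    simpa only [sub_div] using hl.sub hk
  have hkl : ∀ᶠ n in atTop, k n < l n := by
    filter_upwards [hNlim.eventually (lt_mem_nhds he), hpos] with n h1 h2
    have h2' : (0 : ℝ) < (n : ℝ) ^ 2 := by positivity
    have := (div_pos_iff_of_pos_right h2').mp h1
    exact_mod_cast sub_pos.mp this
  have hr : Tendsto (fun n : ℕ => (n : ℝ) ^ 2 / ((l n - k n : ℕ) : ℝ)) atTop
      (𝓝 (d - c)⁻¹) := by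
    refine (hNlim.inv₀ he.ne').congr' ?_
    filter_upwards [hkl] with n h
    rw [inv_div, Nat.cast_sub h.le]
  have hinv : Tendsto (fun n : ℕ => ((n : ℝ))⁻¹) atTop (𝓝 0) := tendsto_inv_atTop_nhds_zero_nat
  have hnN : ∀ᶠ n in atTop, n ≤ l n - k n := by
    have h0 : Tendsto (fun n : ℕ => (n : ℝ) ^ 2 / ((l n - k n : ℕ) : ℝ) * (n : ℝ)⁻¹) atTop
        (𝓝 0) := by simpa using hr.mul hinv
    filter_upwards [h0.eventually (gt_mem_nhds one_pos), hkl, hpos] with n h1 h2 h3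
    have h3' : (0 : ℝ) < n := by exact_mod_cast h3
    have h4 : (0 : ℝ) < ((l n - k n : ℕ) : ℝ) := by exact_mod_cast Nat.sub_pos_of_lt h2
    have h5 : (n : ℝ) ^ 2 / ((l n - k n : ℕ) : ℝ) * (n : ℝ)⁻¹ = n / ((l n - k n : ℕ) : ℝ) := by
      field_simp
    rw [h5, div_lt_one h4] at h1
    exact_mod_cast h1.le
  -- The uniform error of replacing birthday probabilities by their limit tends to zero.
  have hδ : Tendsto (fun n : ℕ => ((n : ℝ) ^ 2 / ((l n - k n : ℕ) : ℝ)) ^ 2 / n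
      + |(n : ℝ) ^ 2 / ((l n - k n : ℕ) : ℝ) / 2 - 1 / (2 * (d - c))|
      + (n : ℝ) ^ 2 / ((l n - k n : ℕ) : ℝ) / (2 * n)) atTop (𝓝 0) := by
    have h1 := (hr.pow 2).mul hinv
    have h2 := ((hr.div_const 2).sub_const (1 / (2 * (d - c)))).abs
    have h3 := (hr.div_const 2).mul hinv
    have h4 : (d - c)⁻¹ / 2 - 1 / (2 * (d - c)) = 0 := by field_simp; ring
    rw [h4] at h2
    have := (h1.add h2).add h3
    simp only [mul_zero, abs_zero, add_zero] at this
    refine this.congr fun n => ?_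
    simp only [div_eq_mul_inv, mul_inv]
    ring
  let p : ℕ → unitInterval := fun n => Set.projIcc 0 1 zero_le_one (((l n : ℝ) - k n) / l n)
  have hp : ∀ᶠ n in atTop, (p n : ℝ) = ((l n : ℝ) - k n) / l n := by
    filter_upwards [hkl] with n h
    have h1 : (k n : ℝ) < l n := by exact_mod_cast h
    have h2 : (0 : ℝ) ≤ k n := by positivity
    simp only [p]
    rw [Set.projIcc_of_mem zero_le_one]
    exact ⟨div_nonneg (by linarith) (by linarith), (div_le_one (by linarith)).mpr (by linarith)⟩
  let q : unitInterval := ⟨(d - c) / d, div_nonneg he.le hd.le, (div_le_one hd).mpr (by linarith)⟩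
  have hpq : Tendsto p atTop (𝓝 q) := by
    rw [tendsto_subtype_rng]
    refine ((hNlim.div hl hd.ne').congr' ?_)
    filter_upwards [hp, hpos] with n h1 h2
    have h2' : (n : ℝ) ≠ 0 := by positivity
    rw [h1]
    simp only [Pi.div_apply]
    field_simp
  have hB : Tendsto (fun n => bernsteinApproximation n (noCollisionLimit (d - c)) (p n)) atTop
      (𝓝 (noCollisionLimit (d - c) q)) :=
    ((continuous_eval (F := C(unitInterval, ℝ))).tendsto
      (noCollisionLimit (d - c), q)).comp
      ((bernsteinApproximation_uniform (noCollisionLimit (d - c))).prodMk_nhds hpq)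
  have hq : noCollisionLimit (d - c) q = Real.exp (-((d - c) / (2 * d ^ 2))) := by
    simp only [noCollisionLimit, ContinuousMap.coe_mk, q]
    congr 2
    field_simp
  rw [← hq]
  refine tendsto_of_tendsto_of_dist hB (squeeze_zero' (.of_forall fun _ => dist_nonneg) ?_ hδ)
  filter_upwards [hp, hkl, hnN, hpos] with n h1 h2 h3 h4
  rw [detachmentTransition_eq_sum_bernstein h2 (p n) h1, bernsteinApproximation.apply, dist_comm,
    Real.dist_eq, ← Finset.sum_sub_distrib]
  refine (Finset.abs_sum_le_sum_abs _ _).trans ?_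
  refine le_of_le_of_eq ?_
    ((congrArg (· * _) (bernstein.probability n (p n))).trans (one_mul _))
  rw [Finset.sum_mul]
  refine Finset.sum_le_sum fun m _ => ?_
  rw [smul_eq_mul, ← mul_sub, abs_mul, abs_of_nonneg bernstein_nonneg]
  refine mul_le_mul_of_nonneg_left ?_ bernstein_nonneg
  have := abs_birthday_sub_noCollisionLimit_le h4 h3 he (Nat.lt_succ_iff.mp m.2)
  simpa only [noCollisionLimit, ContinuousMap.coe_mk, bernstein.z] using this

/-! ### Independence of past and future relocations -/

theorem lonelyCount_eq_iff_injective {n : ℕ} (b : Fin n → ℕ) :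
    lonelyCount b = n ↔ Function.Injective b := by
  have : lonelyCount b = n ↔
      (Finset.univ.filter fun i => ∀ j, j ≠ i → b j ≠ b i) = Finset.univ := by
    rw [← Finset.card_eq_iff_eq_univ, Fintype.card_fin, lonelyCount]
  rw [this, Finset.filter_eq_self]
  constructor
  · intro h i j hij
    by_contra hne
    exact h j (Finset.mem_univ _) i hne hij
  · intro h i _ j hji hb
    exact hji (h hb)

/-- The event that passenger `p.2` relocates at time `p.1 + 1`. At time `1` (`p.1 = 0`) every
passenger is regarded as relocating, to bus `1`. -/
def relocation {Ω : Type*} {n : ℕ} (B : ℕ → Ω → Fin n → ℕ) (p : ℕ × Fin n) : Set Ω :=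
  {ω | B (p.1 + 1) ω p.2 = p.1 + 1}

/-- The σ-algebra generated by the relocations at times `1, …, k`. -/
abbrev relocationHistory {Ω : Type*} {n : ℕ} (B : ℕ → Ω → Fin n → ℕ) (k : ℕ) : MeasurableSpace Ω :=
  MeasurableSpace.generateFrom {t | ∃ p ∈ {p : ℕ × Fin n | p.1 < k}, relocation B p = t}

/-- The σ-algebra generated by the relocations after time `k`. -/
abbrev relocationFuture {Ω : Type*} {n : ℕ} (B : ℕ → Ω → Fin n → ℕ) (k : ℕ) : MeasurableSpace Ω :=
  MeasurableSpace.generateFrom {t | ∃ p ∈ {p : ℕ × Fin n | k ≤ p.1}, relocation B p = t}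

/-- The time of the last relocation of passenger `i` among the times `k + 1, …, k + j`, and `k` if
there is none. -/
def lastRelocation {Ω : Type*} {n : ℕ} (B : ℕ → Ω → Fin n → ℕ) (k : ℕ) : ℕ → Ω → Fin n → ℕ
  | 0, _, _ => k
  | j + 1, ω, i =>
    if B (k + j + 1) ω i = k + j + 1 then k + j + 1 else lastRelocation B k j ω i

/-- For `x` in `[k, k + j]`, the last relocation of `i` in `(k, k + j]` is at `x` precisely if the
events `lastRelocationEvent B k x (r, i)`, `r < j`, all occur: a relocation at `x`, and none
afterwards. -/
def lastRelocationEvent {Ω : Type*} {n : ℕ} (B : ℕ → Ω → Fin n → ℕ) (k : ℕ) (x : ℕ)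
    (p : ℕ × Fin n) : Set Ω :=
  if k + p.1 + 1 < x then Set.univ
  else if k + p.1 + 1 = x then relocation B (k + p.1, p.2)
  else (relocation B (k + p.1, p.2))ᶜ

section

variable {Ω : Type*} {n : ℕ} {B : ℕ → Ω → Fin n → ℕ}

theorem relocationHistory_mono {k l : ℕ} (hkl : k ≤ l) :
    relocationHistory B k ≤ relocationHistory B l :=
  MeasurableSpace.generateFrom_mono fun _ ⟨p, hp, h⟩ => ⟨p, lt_of_lt_of_le hp hkl, h⟩

theorem le_lastRelocation (k j : ℕ) (ω : Ω) (i : Fin n) : k ≤ lastRelocation B k j ω i := by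
  induction j with
  | zero => exact le_rfl
  | succ j ih => rw [lastRelocation]; split_ifs <;> omega

theorem lastRelocation_le (k j : ℕ) (ω : Ω) (i : Fin n) : lastRelocation B k j ω i ≤ k + j := by
  induction j with
  | zero => exact le_rfl
  | succ j ih => rw [lastRelocation]; split_ifs <;> omega

theorem lastRelocation_eq_iff (k j : ℕ) (ω : Ω) (i : Fin n) {x : ℕ} (hx : k ≤ x)
    (hxj : x ≤ k + j) :
    lastRelocation B k j ω i = x ↔ ∀ r < j, ω ∈ lastRelocationEvent B k x (r, i) := by
  induction j with
  | zero =>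
    simp only [lastRelocation, not_lt_zero, false_imp_iff, implies_true, iff_true]
    omega
  | succ j ih =>
    rw [lastRelocation, Nat.forall_lt_succ_right]
    by_cases hxj' : x ≤ k + j
    · have he : lastRelocationEvent B k x (j, i) = (relocation B (k + j, i))ᶜ := by
        rw [lastRelocationEvent, if_neg (by dsimp only; omega), if_neg (by dsimp only; omega)]
      rw [← ih hxj', he]
      change _ ↔ _ ∧ ¬ (B (k + j + 1) ω i = k + j + 1)
      split_ifs with h
      · simp only [h, not_true_eq_false, and_false, iff_false]
        omega
      · simp only [h, not_false_eq_true, and_true]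
    · have hx : x = k + j + 1 := by omega
      have h1 : ∀ r < j, ω ∈ lastRelocationEvent B k x (r, i) := by
        intro r hr
        rw [lastRelocationEvent, if_pos (by dsimp only; omega)]
        trivial
      have he : lastRelocationEvent B k x (j, i) = relocation B (k + j, i) := by
        rw [lastRelocationEvent, if_neg (by dsimp only; omega), if_pos (by dsimp only; omega)]
      rw [eq_true h1, true_and, he]
      change _ ↔ B (k + j + 1) ω i = k + j + 1
      have := lastRelocation_le (B := B) k j ω i
      split_ifs with h
      · simp only [h, hx]
      · simp only [h, iff_false]
        omega

theorem setOf_lastRelocation_eq (k j : ℕ) {f : Fin n → ℕ} (hf : ∀ i, k ≤ f i)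
    (hfj : ∀ i, f i ≤ k + j) :
    {ω | lastRelocation B k j ω = f} = ⋂ p ∈ Finset.range j ×ˢ (Finset.univ : Finset (Fin n)),
      lastRelocationEvent B k (f p.2) p := by
  ext ω
  simp only [Set.mem_ofPred_eq, funext_iff, lastRelocation_eq_iff k j ω _ (hf _) (hfj _),
    Set.mem_iInter, Finset.mem_product, Finset.mem_range, Finset.mem_univ, and_true, Prod.forall]
  exact ⟨fun h r i hr => h i r hr, fun h i r hr => h r i hr⟩

theorem measurableSet_lastRelocationEvent_future (k x : ℕ) (p : ℕ × Fin n) :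
    MeasurableSet[relocationFuture B k] (lastRelocationEvent B k x p) := by
  have h : MeasurableSet[relocationFuture B k] (relocation B (k + p.1, p.2)) :=
    MeasurableSpace.measurableSet_generateFrom ⟨_, Nat.le_add_right _ _, rfl⟩
  rw [lastRelocationEvent]
  split_ifs
  · exact MeasurableSet.univ
  · exact h
  · exact h.compl

namespace IsDetachmentProcess

variable [MeasurableSpace Ω] {P : Measure Ω}

theorem eq_lastRelocation (h : IsDetachmentProcess P n B) (k j : ℕ) (ω : Ω) (i : Fin n) :
    B (k + j) ω i = if lastRelocation B k j ω i = k then B k ω i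
      else lastRelocation B k j ω i := by
  induction j with
  | zero => simp [lastRelocation]
  | succ j ih =>
    rw [lastRelocation, ← add_assoc]
    by_cases h1 : B (k + j + 1) ω i = k + j + 1
    · rw [if_pos h1, if_neg (by omega), h1]
    · have h2 : B (k + j + 1) ω i = B (k + j) ω i := by
        rcases Nat.eq_zero_or_pos (k + j) with h0 | h0
        · rw [h0] at h1
          exact absurd (h.start ω i) h1
        · obtain ⟨r, hr⟩ := Nat.exists_eq_succ_of_ne_zero h0.ne'
          rw [hr] at h1 ⊢
          exact (h.step r ω i).resolve_left h1
      rw [if_neg h1, h2, ih]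

theorem le (h : IsDetachmentProcess P n B) {k : ℕ} (hk : 1 ≤ k) (ω : Ω) (i : Fin n) :
    B k ω i ≤ k := by
  obtain ⟨j, rfl⟩ := Nat.exists_eq_add_of_le hk
  rw [h.eq_lastRelocation 1 j ω i, h.start]
  have := lastRelocation_le (B := B) 1 j ω i
  split_ifs <;> omega

theorem measurableSet_relocation (h : IsDetachmentProcess P n B) (p : ℕ × Fin n) :
    MeasurableSet (relocation B p) :=
  ((measurable_pi_apply p.2).comp (h.measurable (p.1 + 1) (by omega)))
    (MeasurableSet.singleton _)

theorem relocation_zero (h : IsDetachmentProcess P n B) (i : Fin n) :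
    relocation B (0, i) = Set.univ :=
  Set.eq_univ_of_forall fun ω => h.start ω i

theorem measurable_history (h : IsDetachmentProcess P n B) {k : ℕ} (hk : 1 ≤ k) :
    Measurable[relocationHistory B k] (B k) := by
  obtain ⟨k, rfl⟩ := Nat.exists_eq_add_of_le' hk
  refine @measurable_pi_lambda _ _ _ (_) _ _ fun i => ?_
  induction k with
  | zero =>
    simp only [zero_add, h.start]
    exact @measurable_const _ _ _ (_) _
  | succ k ih =>
    have hr : MeasurableSet[relocationHistory B (k + 1 + 1)] {ω | B (k + 2) ω i = k + 2} :=
      MeasurableSpace.measurableSet_generateFrom ⟨(k + 1, i), Nat.lt_succ_self _, rfl⟩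
    have heq : (fun ω => B (k + 1 + 1) ω i)
        = fun ω => if B (k + 2) ω i = k + 2 then k + 2 else B (k + 1) ω i := by
      funext ω
      split_ifs with h1
      · exact h1
      · exact (h.step k ω i).resolve_left h1
    rw [heq]
    exact @Measurable.ite _ _ (_) _ _ _ _ _ hr (@measurable_const _ _ _ (_) _)
      ((ih (by omega)).mono (relocationHistory_mono (Nat.le_succ _)) le_rfl)

theorem measurableSet_injective_history (h : IsDetachmentProcess P n B) {k : ℕ} (hk : 1 ≤ k) :
    MeasurableSet[relocationHistory B k] {ω | Function.Injective (B k ω)} :=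
  h.measurable_history hk (MeasurableSet.of_discrete (s := {b | Function.Injective b}))

variable [IsProbabilityMeasure P]

theorem real_relocation (h : IsDetachmentProcess P n B) (k : ℕ) (i : Fin n) :
    P.real (relocation B (k, i)) = 1 / ((k : ℝ) + 1) := by
  rcases k with _ | k
  · simp [h.relocation_zero]
  · have : P (relocation B (k + 1, i)) = ENNReal.ofReal (1 / ((k : ℝ) + 2)) := h.prob k i
    rw [Measure.real, this, ENNReal.toReal_ofReal (by positivity)]
    push_cast
    ring

theorem iIndepSet_relocation (h : IsDetachmentProcess P n B) : iIndepSet (relocation B) P := by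
  rw [iIndepSet_iff_meas_biInter h.measurableSet_relocation]
  intro t
  have hm : ∀ p : ℕ × Fin n, MeasurableSet {ω | B (p.1 + 2) ω p.2 = p.1 + 2} := fun p =>
    h.measurableSet_relocation (p.1 + 1, p.2)
  have hind := (iIndepSet_iff_meas_biInter hm).mp h.indep
  let φ : ℕ × Fin n → ℕ × Fin n := fun p => (p.1 + 1, p.2)
  have hφ : Function.Injective φ := by
    rintro ⟨a, i⟩ ⟨b, j⟩ hab
    simpa [φ] using hab
  have huniv : ∀ p ∈ t, p ∉ Set.range φ → relocation B p = Set.univ := by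
    rintro ⟨k, i⟩ _ hk
    rcases k with _ | k
    · exact h.relocation_zero i
    · exact absurd ⟨(k, i), rfl⟩ hk
  rw [← Finset.prod_preimage φ t hφ.injOn (fun p => P (relocation B p))
    (fun p hp hpr => by rw [huniv p hp hpr, measure_univ])]
  refine Eq.trans ?_ (hind (t.preimage φ hφ.injOn))
  congr 1
  ext ω
  simp only [Set.mem_iInter, Finset.mem_preimage]
  refine ⟨fun hω p hp => hω (φ p) hp, fun hω p hp => ?_⟩
  by_cases hpr : p ∈ Set.range φ
  · obtain ⟨q, rfl⟩ := hpr
    exact hω q hp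
  · rw [huniv p hp hpr]
    trivial

theorem indep_history_future (h : IsDetachmentProcess P n B) (k : ℕ) :
    Indep (relocationHistory B k) (relocationFuture B k) P :=
  h.iIndepSet_relocation.indep_generateFrom_of_disjoint h.measurableSet_relocation _ _
    (Set.disjoint_left.mpr fun p (hp : p.1 < k) (hp' : k ≤ p.1) => (lt_of_lt_of_le hp hp').false)

theorem real_lastRelocationEvent (h : IsDetachmentProcess P n B) (k x r : ℕ) (i : Fin n) :
    P.real (lastRelocationEvent B k x (r, i)) = if k + r + 1 < x then 1
      else if k + r + 1 = x then 1 / ((k : ℝ) + r + 1) else ((k : ℝ) + r) / ((k : ℝ) + r + 1) := by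
  have h0 : ((k : ℝ) + r + 1) ≠ 0 := by positivity
  rw [lastRelocationEvent]
  split_ifs
  · exact probReal_univ
  · rw [h.real_relocation]
    push_cast
    rfl
  · rw [probReal_compl_eq_one_sub (h.measurableSet_relocation _), h.real_relocation]
    push_cast
    field_simp
    ring

/-- The probability that the last relocation of `i` in `(k, k + j]` is at `x` is `1 / (k + j)`, and
the probability that there is none is `k / (k + j)`. -/
theorem prod_real_lastRelocationEvent (h : IsDetachmentProcess P n B) (k j : ℕ) (i : Fin n)
    {x : ℕ} (hx : k ≤ x) (hxj : x ≤ k + j) :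
    ((k : ℝ) + j) * ∏ r ∈ Finset.range j, P.real (lastRelocationEvent B k x (r, i))
      = if x = k then (k : ℝ) else 1 := by
  induction j with
  | zero =>
    rw [if_pos (by omega)]
    simp
  | succ j ih =>
    have h0 : ((k : ℝ) + j + 1) ≠ 0 := by positivity
    rw [Finset.prod_range_succ, h.real_lastRelocationEvent k x j]
    by_cases hxj' : x ≤ k + j
    · rw [← ih hxj', if_neg (by omega), if_neg (by omega)]
      push_cast
      field_simp
      ring
    · have h1 : ∏ r ∈ Finset.range j, P.real (lastRelocationEvent B k x (r, i)) = 1 := by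
        refine Finset.prod_eq_one fun r hr => ?_
        rw [h.real_lastRelocationEvent, if_pos]
        have := Finset.mem_range.mp hr
        omega
      rw [h1, if_neg (by omega), if_pos (by omega), if_neg (by omega)]
      push_cast
      field_simp
      ring

theorem real_lastRelocation_eq (h : IsDetachmentProcess P n B) (k j : ℕ) (hkj : 0 < k + j)
    {f : Fin n → ℕ} (hf : ∀ i, k ≤ f i) (hfj : ∀ i, f i ≤ k + j) :
    P.real {ω | lastRelocation B k j ω = f}
      = ∏ i, (if f i = k then (k : ℝ) else 1) / ((k : ℝ) + j) := by
  have hkj' : ((k : ℝ) + j) ≠ 0 := by exact_mod_cast hkj.ne'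
  -- Distinct `p` address distinct relocation events.
  have hind := (iIndepSet.precomp (g := fun p : ℕ × Fin n => (k + p.1, p.2))
    (by rintro ⟨a, i⟩ ⟨b, i'⟩ hab; simpa using hab) h.iIndepSet_relocation)
  rw [setOf_lastRelocation_eq k j hf hfj, Measure.real, iIndep.meas_biInter hind,
    ENNReal.toReal_prod, Finset.prod_product_right]
  · refine Finset.prod_congr rfl fun i _ => ?_
    rw [eq_div_iff hkj', mul_comm]
    exact h.prod_real_lastRelocationEvent k j i (hf i) (hfj i)
  · intro p _
    have hm : MeasurableSet[MeasurableSpace.generateFrom {relocation B (k + p.1, p.2)}]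
      (relocation B (k + p.1, p.2)) := MeasurableSpace.measurableSet_generateFrom rfl
    rw [lastRelocationEvent]
    split_ifs
    · exact MeasurableSet.univ
    · exact hm
    · exact hm.compl

end IsDetachmentProcess

end

/-! ### The transition probability of the detachment process -/

/-- The possible last relocation times in `(k, l]` (with `k` standing for no relocation) which give
distinct buses to the passengers that have relocated. -/
def detachedRelocations (n k l : ℕ) : Finset (Fin n → ℕ) :=
  (Fintype.piFinset fun _ => Finset.Icc k l).filter
    fun f => ∀ i j, f i = f j → f i ≠ k → i = j

theorem mem_detachedRelocations {n k l : ℕ} {f : Fin n → ℕ} :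
    f ∈ detachedRelocations n k l ↔
      (∀ i, k ≤ f i ∧ f i ≤ l) ∧ ∀ i j, f i = f j → f i ≠ k → i = j := by
  simp [detachedRelocations]

/-- The elements of `detachedRelocations n k l` for which `S` is the set of passengers that
relocate are the embeddings of `S` into `(k, l]`. -/
theorem card_detachedRelocations_filter (n k l : ℕ) (hkl : k ≤ l) (S : Finset (Fin n)) :
    ((detachedRelocations n k l).filter
      fun f => (Finset.univ.filter fun i => f i ≠ k) = S).card
      = (l - k).descFactorial S.card := by
  have hcard : (Finset.univ : Finset (S ↪ Finset.Ioc k l)).card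
      = (l - k).descFactorial S.card := by
    rw [Finset.card_univ, Fintype.card_embedding_eq, Fintype.card_coe, Fintype.card_coe,
      Nat.card_Ioc]
  rw [← hcard]
  symm
  refine Finset.card_bij
    (fun e _ i => if hi : i ∈ S then ((e ⟨i, hi⟩ : Finset.Ioc k l) : ℕ) else k) ?_ ?_ ?_
  · intro e _
    have he : ∀ i (hi : i ∈ S), k < (e ⟨i, hi⟩ : ℕ) ∧ (e ⟨i, hi⟩ : ℕ) ≤ l := fun i hi =>
      Finset.mem_Ioc.mp (e ⟨i, hi⟩).2
    rw [Finset.mem_filter, mem_detachedRelocations]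
    refine ⟨⟨fun i => ?_, fun i j hij hik => ?_⟩, ?_⟩
    · split_ifs with hi
      · exact ⟨(he i hi).1.le, (he i hi).2⟩
      · exact ⟨le_rfl, hkl⟩
    · by_cases hi : i ∈ S
      · by_cases hj : j ∈ S
        · simp only [hi, hj, dite_true] at hij
          simpa using e.injective (Subtype.ext hij)
        · simp only [hi, hj, dite_true, dite_false] at hij
          exact absurd hij (he i hi).1.ne'
      · simp [hi] at hik
    · ext i
      simp only [Finset.mem_filter, Finset.mem_univ, true_and]
      by_cases hi : i ∈ S
      · simp only [hi, dite_true, iff_true]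
        exact (he i hi).1.ne'
      · simp [hi]
  · intro e _ e' _ hee
    ext ⟨i, hi⟩
    have := congrFun hee i
    simpa [hi] using this
  · intro f hf
    rw [Finset.mem_filter, mem_detachedRelocations] at hf
    obtain ⟨⟨hb, hinj⟩, rfl⟩ := hf
    have hne : ∀ i : {i // i ∈ Finset.univ.filter fun i => f i ≠ k}, f i ≠ k := fun i =>
      (Finset.mem_filter.mp i.2).2
    refine ⟨⟨fun i => ⟨f i, Finset.mem_Ioc.mpr
      ⟨lt_of_le_of_ne (hb i).1 (hne i).symm, (hb i).2⟩⟩, fun i j hij => ?_⟩,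
      Finset.mem_univ _, ?_⟩
    · exact Subtype.ext (hinj i j (congrArg Subtype.val hij) (hne i))
    · funext i
      by_cases hi : f i = k
      · simp [hi]
      · rw [dif_pos (by simp [hi])]
        rfl

theorem sum_detachedRelocations (n k l : ℕ) (hkl : k ≤ l) :
    ∑ f ∈ detachedRelocations n k l, ∏ i, (if f i = k then (k : ℝ) else 1) / (l : ℝ)
      = detachmentTransition n k l := by
  rw [← Finset.sum_fiberwise_of_maps_to
    (t := (Finset.univ : Finset (Fin n)).powerset)
    (g := fun f : Fin n → ℕ => Finset.univ.filter fun i => f i ≠ k)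
    (fun f _ => Finset.mem_powerset.mpr (Finset.subset_univ _))]
  have hS : ∀ S ∈ (Finset.univ : Finset (Fin n)).powerset,
      ∑ f ∈ (detachedRelocations n k l).filter
        (fun f => (Finset.univ.filter fun i => f i ≠ k) = S),
        ∏ i, (if f i = k then (k : ℝ) else 1) / (l : ℝ)
      = (fun m : ℕ => ((l - k).descFactorial m : ℝ) *
          (((k : ℝ) / l) ^ (n - m) * (1 / (l : ℝ)) ^ m)) S.card := by
    intro S _
    dsimp only
    rw [← card_detachedRelocations_filter n k l hkl S, ← nsmul_eq_mul]
    refine Finset.sum_eq_card_nsmul fun f hf => ?_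
    obtain ⟨_, rfl⟩ := Finset.mem_filter.mp hf
    rw [← Finset.prod_filter_mul_prod_filter_not Finset.univ (fun i => f i ≠ k), mul_comm]
    congr 1
    · rw [Finset.prod_congr rfl (g := fun _ => (k : ℝ) / l), Finset.prod_const]
      · congr 1
        have := Finset.card_filter_add_card_filter_not (s := (Finset.univ : Finset (Fin n)))
          (fun i => f i ≠ k)
        rw [Finset.card_univ, Fintype.card_fin] at this
        omega
      · intro i hi
        rw [if_pos (not_not.mp (Finset.mem_filter.mp hi).2)]
    · rw [Finset.prod_congr rfl (g := fun _ => 1 / (l : ℝ)), Finset.prod_const]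
      intro i hi
      rw [if_neg (Finset.mem_filter.mp hi).2]
  rw [Finset.sum_congr rfl hS, Finset.sum_powerset_apply_card (x := (Finset.univ : Finset (Fin n)))
    (fun m : ℕ => ((l - k).descFactorial m : ℝ) *
          (((k : ℝ) / l) ^ (n - m) * (1 / (l : ℝ)) ^ m)), Finset.card_univ, Fintype.card_fin,
    detachmentTransition]
  refine Finset.sum_congr rfl fun m _ => ?_
  rw [nsmul_eq_mul, div_pow 1, one_pow]
  ring

namespace IsDetachmentProcess

variable {Ω : Type*} [MeasurableSpace Ω] {n : ℕ} {B : ℕ → Ω → Fin n → ℕ} {P : Measure Ω}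

theorem relocationHistory_le (h : IsDetachmentProcess P n B) (k : ℕ) :
    relocationHistory B k ≤ ‹MeasurableSpace Ω› :=
  MeasurableSpace.generateFrom_le fun _ ⟨p, _, hp⟩ => hp ▸ h.measurableSet_relocation p

theorem relocationFuture_le (h : IsDetachmentProcess P n B) (k : ℕ) :
    relocationFuture B k ≤ ‹MeasurableSpace Ω› :=
  MeasurableSpace.generateFrom_le fun _ ⟨p, _, hp⟩ => hp ▸ h.measurableSet_relocation p

/-- Starting from a state of detachment at time `k`, the process is in a state of detachment at
time `k + j` precisely if the passengers that have relocated are in distinct buses. -/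
theorem injective_iff_lastRelocation_mem (h : IsDetachmentProcess P n B) {k j : ℕ}
    (hkj : 0 < k + j) {ω : Ω} (hω : k = 0 ∨ Function.Injective (B k ω)) :
    Function.Injective (B (k + j) ω) ↔
      lastRelocation B k j ω ∈ detachedRelocations n k (k + j) := by
  rw [mem_detachedRelocations]
  have hb : ∀ i, k ≤ lastRelocation B k j ω i ∧ lastRelocation B k j ω i ≤ k + j := fun i =>
    ⟨le_lastRelocation k j ω i, lastRelocation_le k j ω i⟩
  have hB : ∀ i, B (k + j) ω i = if lastRelocation B k j ω i = k then B k ω i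
      else lastRelocation B k j ω i := h.eq_lastRelocation k j ω
  -- At time `0` nobody has a bus, but everybody relocates at time `1`.
  have h0 : k = 0 → ∀ i, lastRelocation B k j ω i ≠ k := by
    rintro rfl i h1
    obtain ⟨j, rfl⟩ : ∃ r, j = r + 1 := Nat.exists_eq_succ_of_ne_zero (by omega)
    have := (lastRelocation_eq_iff 0 (j + 1) ω i le_rfl (by omega)).mp h1 0 (by omega)
    rw [lastRelocationEvent, if_neg (by dsimp only; omega), if_neg (by dsimp only; omega)] at this
    exact this (h.start ω i)
  have hlt : k ≠ 0 → ∀ i, B k ω i ≤ k := fun hk i => h.le (Nat.one_le_iff_ne_zero.mpr hk) ω i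
  constructor
  · intro hinj
    refine ⟨hb, fun i i' hii hik => hinj ?_⟩
    rw [hB, hB, if_neg hik, if_neg (hii ▸ hik), hii]
  · rintro ⟨-, hinj⟩ i i' hii
    rw [hB, hB] at hii
    by_cases h1 : lastRelocation B k j ω i = k <;> by_cases h2 : lastRelocation B k j ω i' = k
    · rw [if_pos h1, if_pos h2] at hii
      exact hω.resolve_left (fun hk => h0 hk i h1) hii
    · rw [if_pos h1, if_neg h2] at hii
      have := hlt (fun hk => h0 hk i h1) i
      have := hb i'
      omega
    · rw [if_neg h1, if_pos h2] at hii
      have := hlt (fun hk => h0 hk i' h2) i'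
      have := hb i
      omega
    · rw [if_neg h1, if_neg h2] at hii
      exact hinj i i' hii h1

/-- The regeneration property: given a state of detachment at time `k`, the past before `k` is
irrelevant for the event of a state of detachment at a later time `l`. -/
theorem real_inter_injective [IsProbabilityMeasure P] (h : IsDetachmentProcess P n B) {k l : ℕ}
    (hkl : k ≤ l) (hl : 0 < l) {G : Set Ω} (hG : MeasurableSet[relocationHistory B k] G)
    (hGk : ∀ ω ∈ G, k = 0 ∨ Function.Injective (B k ω)) :
    P.real (G ∩ {ω | Function.Injective (B l ω)}) = P.real G * detachmentTransition n k l := by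
  obtain ⟨j, rfl⟩ := Nat.exists_eq_add_of_le hkl
  have hset : G ∩ {ω | Function.Injective (B (k + j) ω)}
      = ⋃ f ∈ detachedRelocations n k (k + j), G ∩ {ω | lastRelocation B k j ω = f} := by
    ext ω
    simp only [Set.mem_inter_iff, Set.mem_ofPred_eq, Set.mem_iUnion, exists_prop]
    constructor
    · rintro ⟨h1, h2⟩
      exact ⟨_, (h.injective_iff_lastRelocation_mem hl (hGk ω h1)).mp h2, h1, rfl⟩
    · rintro ⟨f, hf, h1, rfl⟩
      exact ⟨h1, (h.injective_iff_lastRelocation_mem hl (hGk ω h1)).mpr hf⟩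
  have hfut : ∀ f ∈ detachedRelocations n k (k + j),
      MeasurableSet[relocationFuture B k] {ω | lastRelocation B k j ω = f} := by
    intro f hf
    have hb := (mem_detachedRelocations.mp hf).1
    rw [setOf_lastRelocation_eq k j (fun i => (hb i).1) (fun i => (hb i).2)]
    exact Finset.measurableSet_biInter _ fun p _ =>
      measurableSet_lastRelocationEvent_future k (f p.2) p
  rw [hset, measureReal_biUnion_finset, ← sum_detachedRelocations n k (k + j) hkl,
    Finset.mul_sum]
  · refine Finset.sum_congr rfl fun f hf => ?_
    have hb := (mem_detachedRelocations.mp hf).1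
    have hind := (Indep_iff _ _ P).mp (h.indep_history_future k) _ _ hG (hfut f hf)
    rw [Measure.real, hind, ENNReal.toReal_mul]
    congr 1
    have := h.real_lastRelocation_eq k j hl (fun i => (hb i).1) (fun i => (hb i).2)
    rw [Measure.real] at this
    rw [this, Nat.cast_add]
  · intro f _ g _ hfg
    refine Set.disjoint_left.mpr ?_
    rintro ω ⟨-, h1⟩ ⟨-, h2⟩
    exact hfg (h1.symm.trans h2)
  · exact fun f hf => (h.relocationHistory_le k _ hG).inter
      (h.relocationFuture_le k _ (hfut f hf))

end IsDetachmentProcess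

/-! ### The detachment indicator at several rescaled times -/

/-- The integer time at which the `n`-detachment process is observed at rescaled time `t`. -/
noncomputable def observationTime (n : ℕ) (t : ℝ) : ℕ :=
  max 1 ⌊t * (n : ℝ) ^ 2⌋₊

theorem one_le_observationTime (n : ℕ) (t : ℝ) : 1 ≤ observationTime n t := le_max_left _ _

theorem observationTime_mono (n : ℕ) {s t : ℝ} (hst : s ≤ t) :
    observationTime n s ≤ observationTime n t := by
  unfold observationTime
  gcongr

theorem tendsto_observationTime_div {t : ℝ} (ht : 0 < t) :
    Tendsto (fun n : ℕ => (observationTime n t : ℝ) / (n : ℝ) ^ 2) atTop (𝓝 t) := by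
  have hsq : Tendsto (fun n : ℕ => (n : ℝ) ^ 2) atTop atTop :=
    (tendsto_pow_atTop two_ne_zero).comp tendsto_natCast_atTop_atTop
  refine ((tendsto_nat_floor_mul_div_atTop ht.le).comp hsq).congr' ?_
  filter_upwards [(hsq.const_mul_atTop ht).eventually_ge_atTop 1] with n hn
  have : 1 ≤ ⌊t * (n : ℝ) ^ 2⌋₊ := (Nat.one_le_floor_iff _).mpr hn
  simp only [Function.comp_apply, observationTime, max_eq_right this]

theorem detachmentIndicator_eq_ite {Ω : Type*} {n : ℕ} (B : ℕ → Ω → Fin n → ℕ) (t : ℝ) (ω : Ω)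
    [Decidable (Function.Injective (B (observationTime n t) ω))] :
    detachmentIndicator B t ω =
      if Function.Injective (B (observationTime n t) ω) then 1 else 0 := by
  rw [detachmentIndicator]
  exact if_congr (lonelyCount_eq_iff_injective _) rfl rfl

theorem detachmentIndicator_eq_one_iff {Ω : Type*} {n : ℕ} (B : ℕ → Ω → Fin n → ℕ) (t : ℝ)
    (ω : Ω) :
    detachmentIndicator B t ω = 1 ↔ Function.Injective (B (observationTime n t) ω) := by
  classical
  rw [detachmentIndicator_eq_ite]
  split_ifs with h <;> simp [h]

theorem detachmentIndicator_eq_zero_or_one {Ω : Type*} {n : ℕ} (B : ℕ → Ω → Fin n → ℕ) (t : ℝ)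
    (ω : Ω) : detachmentIndicator B t ω = 0 ∨ detachmentIndicator B t ω = 1 := by
  classical
  rw [detachmentIndicator_eq_ite]
  split_ifs <;> simp

theorem IsDetachmentProcess.measurable_detachmentIndicator {Ω : Type*} [MeasurableSpace Ω] {n : ℕ}
    {B : ℕ → Ω → Fin n → ℕ} {P : Measure Ω} (h : IsDetachmentProcess P n B) (t : ℝ) :
    Measurable (detachmentIndicator B t) :=
  (Measurable.of_discrete (f := fun b : Fin n → ℕ =>
    if lonelyCount b = n then (1 : ℝ) else 0)).comp
    (h.measurable _ (one_le_observationTime n t))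

/-- `IsLastTime F c` says that `c` is the largest element of `F`, or `0` if `F` is empty. -/
def IsLastTime (F : Finset ℝ) (c : ℝ) : Prop :=
  (F = ∅ ∧ c = 0) ∨ (c ∈ F ∧ ∀ t ∈ F, t ≤ c)

theorem exists_isLastTime (F : Finset ℝ) : ∃ c, IsLastTime F c := by
  rcases F.eq_empty_or_nonempty with h | h
  · exact ⟨0, Or.inl ⟨h, rfl⟩⟩
  · exact ⟨F.max' h, Or.inr ⟨F.max'_mem h, fun t ht => F.le_max' t ht⟩⟩

theorem IsLastTime.nonneg {F : Finset ℝ} {c : ℝ} (h : IsLastTime F c) (hF : ∀ t ∈ F, 0 < t) :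
    0 ≤ c := by
  rcases h with ⟨-, rfl⟩ | ⟨h, -⟩
  · exact le_rfl
  · exact (hF c h).le

theorem isLastTime_singleton (c : ℝ) : IsLastTime {c} c := Or.inr (by simp)

/-- Induction on finite sets of positive times, adding a new largest time `d` in each step. -/
theorem induction_on_lastTime {p : Finset ℝ → Prop} (F : Finset ℝ) (hF : ∀ t ∈ F, 0 < t)
    (empty : p ∅)
    (insert : ∀ (F : Finset ℝ) (c d : ℝ), (∀ t ∈ F, 0 < t) → IsLastTime F c → c < d →
      p F → p (insert d F)) : p F := by
  induction F using Finset.induction_on_max with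
  | empty => exact empty
  | insert d F hd ih =>
    obtain ⟨c, hc⟩ := exists_isLastTime F
    have hF' : ∀ t ∈ F, 0 < t := fun t ht => hF t (Finset.mem_insert_of_mem ht)
    refine insert F c d hF' hc ?_ (ih hF')
    rcases hc with ⟨-, rfl⟩ | ⟨h, -⟩
    · exact hF d (Finset.mem_insert_self d F)
    · exact hd c h

/-- The state of detachment at all the times in `F`. -/
def detachedAt {Ω : Type*} {n : ℕ} (B : ℕ → Ω → Fin n → ℕ) (F : Finset ℝ) : Set Ω :=
  {ω | ∀ t ∈ F, detachmentIndicator B t ω = 1}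

/-- By regeneration, a new largest time `d` contributes one transition factor. If there is no
earlier time, the transition starts at time `0`. -/
theorem IsDetachmentProcess.real_detachedAt_insert {Ω : Type*} [MeasurableSpace Ω] {n : ℕ}
    {B : ℕ → Ω → Fin n → ℕ} {P : Measure Ω} [IsProbabilityMeasure P]
    (h : IsDetachmentProcess P n B) {F : Finset ℝ} {c d : ℝ} (hc : IsLastTime F c) (hcd : c < d) :
    P.real (detachedAt B (insert d F)) = P.real (detachedAt B F) *
      detachmentTransition n (if F = ∅ then 0 else observationTime n c) (observationTime n d) := by
  have hset : detachedAt B (insert d F)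
      = detachedAt B F ∩ {ω | Function.Injective (B (observationTime n d) ω)} := by
    ext ω
    simp only [detachedAt, detachmentIndicator_eq_one_iff, Set.mem_ofPred_eq, Set.mem_inter_iff,
      Finset.forall_mem_insert]
    exact and_comm
  have hle : ∀ t ∈ F, observationTime n t ≤ if F = ∅ then 0 else observationTime n c := by
    intro t ht
    rw [if_neg (Finset.ne_empty_of_mem ht)]
    rcases hc with ⟨rfl, -⟩ | ⟨-, hc⟩
    · simp at ht
    · exact observationTime_mono n (hc t ht)
  rw [hset]
  refine h.real_inter_injective ?_ (one_le_observationTime n d) ?_ ?_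
  · split_ifs
    · exact Nat.zero_le _
    · exact observationTime_mono n hcd.le
  · have : detachedAt B F = ⋂ t ∈ F, {ω | Function.Injective (B (observationTime n t) ω)} := by
      ext ω
      simp [detachedAt, detachmentIndicator_eq_one_iff]
    rw [this]
    exact Finset.measurableSet_biInter _ fun t ht => relocationHistory_mono (hle t ht) _
      (h.measurableSet_injective_history (one_le_observationTime n t))
  · intro ω hω
    split_ifs with hF
    · exact Or.inl rfl
    · right
      rcases hc with ⟨hF', -⟩ | ⟨hc, -⟩
      · exact absurd hF' hF
      · exact (detachmentIndicator_eq_one_iff B c ω).mp (hω c hc)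

theorem tendsto_detachmentTransition_observationTime {F : Finset ℝ} {c d : ℝ}
    (hF : ∀ t ∈ F, 0 < t) (hc : IsLastTime F c) (hcd : c < d) :
    Tendsto (fun n => detachmentTransition n (if F = ∅ then 0 else observationTime n c)
      (observationTime n d)) atTop (𝓝 (Real.exp (-((d - c) / (2 * d ^ 2))))) := by
  have hc0 := hc.nonneg hF
  refine tendsto_detachmentTransition hc0 hcd ?_
    (tendsto_observationTime_div (hc0.trans_lt hcd))
  rcases hc with ⟨rfl, rfl⟩ | ⟨hc, -⟩
  · simp
  · simp only [if_neg (Finset.ne_empty_of_mem hc)]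
    exact tendsto_observationTime_div (hF c hc)

/-! ### Càdlàg paths -/

/-- A function of `⌊t * a⌋₊` is càdlàg. -/
theorem isCadlagOnPos_comp_floor (g : ℕ → ℝ) (a : ℝ) (ha : 0 ≤ a) :
    IsCadlagOnPos fun t => g ⌊t * a⌋₊ := by
  intro t ht
  rcases ha.eq_or_lt with rfl | ha
  · simp only [mul_zero]
    exact ⟨continuousWithinAt_const, _, tendsto_const_nhds⟩
  have hcont : Continuous fun s : ℝ => s * a := by fun_prop
  constructor
  · refine ContinuousWithinAt.congr_of_eventuallyEq (f := fun _ => g ⌊t * a⌋₊)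
      continuousWithinAt_const ?_ rfl
    filter_upwards [self_mem_nhdsWithin, mem_nhdsWithin_of_mem_nhds
      (hcont.continuousAt.eventually (gt_mem_nhds (Nat.lt_floor_add_one (t * a))))] with s h1 h2
    have h1 : t ≤ s := h1
    congr 1
    have hs : 0 < s := ht.trans_le h1
    refine (Nat.floor_eq_iff (by positivity)).mpr
      ⟨(Nat.floor_le (by positivity)).trans (by gcongr), h2⟩
  · -- On the left of `t` the floor is the largest integer below `t * a`.
    refine ⟨g (⌈t * a⌉₊ - 1), tendsto_const_nhds.congr' ?_⟩
    have hpos : 0 < ⌈t * a⌉₊ := Nat.ceil_pos.mpr (by positivity)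
    have hlt : ((⌈t * a⌉₊ - 1 : ℕ) : ℝ) < t * a := Nat.lt_ceil.mp (by omega)
    filter_upwards [self_mem_nhdsWithin, mem_nhdsWithin_of_mem_nhds
      (hcont.continuousAt.eventually (lt_mem_nhds hlt))] with s h1 h2
    have h1 : s < t := h1
    congr 1
    refine ((Nat.floor_eq_iff ((Nat.cast_nonneg _).trans h2.le)).mpr ⟨h2.le, ?_⟩).symm
    have h3 : (((⌈t * a⌉₊ - 1 : ℕ) : ℝ)) + 1 = ⌈t * a⌉₊ := by
      exact_mod_cast Nat.sub_add_cancel hpos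
    rw [h3]
    exact (mul_lt_mul_of_pos_right h1 ha).trans_le (Nat.le_ceil _)

theorem isCadlagOnPos_detachmentIndicator {Ω : Type*} {n : ℕ} (B : ℕ → Ω → Fin n → ℕ) (ω : Ω) :
    IsCadlagOnPos fun t => detachmentIndicator B t ω :=
  isCadlagOnPos_comp_floor (fun k => if lonelyCount (B (max 1 k) ω) = n then 1 else 0) _
    (by positivity)

/-! ### Poisson clouds of points -/

/-- A Poisson point process with intensity `∑ k, ν k`, where the `ν k` are probability measures:
independently for each `k`, a Poisson(1)-distributed number `(ω k).1` of points is retained from the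
independent sequence `(ω k).2` of points with law `ν k`. -/
noncomputable def poissonCloud {Z : Type*} [MeasurableSpace Z] (ν : ℕ → Measure Z)
    [∀ k, IsProbabilityMeasure (ν k)] : Measure (ℕ → ℕ × (ℕ → Z)) :=
  Measure.infinitePi fun k => (poissonMeasure 1).prod (Measure.infinitePi fun _ : ℕ => ν k)

instance {Z : Type*} [MeasurableSpace Z] (ν : ℕ → Measure Z) [∀ k, IsProbabilityMeasure (ν k)] :
    IsProbabilityMeasure (poissonCloud ν) := by
  unfold poissonCloud
  infer_instance

/-- For each `k`, none of the retained points of the `k`-th sequence lies in `A k`. -/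
def cloudAvoids {Z : Type*} (A : ℕ → Set Z) : Set (ℕ → ℕ × (ℕ → Z)) :=
  {ω | ∀ k, ∀ j < (ω k).1, (ω k).2 j ∉ A k}

section

variable {Z : Type*} [MeasurableSpace Z]

theorem measurableSet_forall_lt_notMem {A : Set Z} (hA : MeasurableSet A) :
    MeasurableSet {x : ℕ × (ℕ → Z) | ∀ j < x.1, x.2 j ∉ A} := by
  have : {x : ℕ × (ℕ → Z) | ∀ j < x.1, x.2 j ∉ A}
      = ⋂ j : ℕ, (Prod.fst ⁻¹' (Set.Ioi j))ᶜ ∪ ((fun x : ℕ × (ℕ → Z) => x.2 j) ⁻¹' A)ᶜ := by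
    ext x
    simp only [Set.mem_ofPred_eq, Set.mem_iInter, Set.mem_union, Set.mem_compl_iff,
      Set.mem_preimage, Set.mem_Ioi, imp_iff_not_or]
  rw [this]
  refine MeasurableSet.iInter fun j => ?_
  exact (measurable_fst (MeasurableSet.of_discrete)).compl.union
    ((((measurable_pi_apply j).comp measurable_snd) hA).compl)

theorem measurableSet_cloudAvoids {A : ℕ → Set Z} (hA : ∀ k, MeasurableSet (A k)) :
    MeasurableSet (cloudAvoids A) := by
  have : cloudAvoids A = ⋂ k, (fun ω : ℕ → ℕ × (ℕ → Z) => ω k) ⁻¹'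
      {x : ℕ × (ℕ → Z) | ∀ j < x.1, x.2 j ∉ A k} := by
    ext ω
    simp [cloudAvoids]
  rw [this]
  exact MeasurableSet.iInter fun k =>
    measurable_pi_apply k (measurableSet_forall_lt_notMem (hA k))

/-- A Poisson(1)-distributed number of independent points with law `ν` avoids `A` with probability
`∑ N, exp (-1) / N! * (1 - ν A) ^ N = exp (- ν A)`. -/
theorem poisson_prod_forall_lt_notMem (ν : Measure Z) [IsProbabilityMeasure ν] {A : Set Z}
    (hA : MeasurableSet A) :
    ((poissonMeasure 1).prod (Measure.infinitePi fun _ : ℕ => ν))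
      {x : ℕ × (ℕ → Z) | ∀ j < x.1, x.2 j ∉ A} = ENNReal.ofReal (Real.exp (-(ν.real A))) := by
  rw [Measure.prod_apply (measurableSet_forall_lt_notMem hA), poissonMeasure,
    lintegral_sum_measure]
  have hN : ∀ N : ℕ, (Measure.infinitePi fun _ : ℕ => ν)
      (Prod.mk N ⁻¹' {x : ℕ × (ℕ → Z) | ∀ j < x.1, x.2 j ∉ A})
      = ENNReal.ofReal (ν.real Aᶜ ^ N) := by
    intro N
    have : Prod.mk N ⁻¹' {x : ℕ × (ℕ → Z) | ∀ j < x.1, x.2 j ∉ A}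
        = Set.pi (Finset.range N : Set ℕ) fun _ => Aᶜ := by
      ext p
      simp [Set.mem_pi]
    rw [this, Measure.infinitePi_pi _ (fun _ _ => hA.compl), Finset.prod_const,
      Finset.card_range, ENNReal.ofReal_pow measureReal_nonneg, ofReal_measureReal]
  have hterm : ∀ N : ℕ, ∫⁻ M, (Measure.infinitePi fun _ : ℕ => ν)
      (Prod.mk M ⁻¹' {x : ℕ × (ℕ → Z) | ∀ j < x.1, x.2 j ∉ A})
      ∂(ENNReal.ofReal (Real.exp (-((1 : NNReal) : ℝ)) * ((1 : NNReal) : ℝ) ^ N / N.factorial)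
        • Measure.dirac N)
      = ENNReal.ofReal (Real.exp (-1) * (ν.real Aᶜ ^ N / N.factorial)) := by
    intro N
    rw [lintegral_smul_measure, lintegral_dirac, hN, smul_eq_mul,
      ← ENNReal.ofReal_mul (by positivity)]
    congr 1
    simp only [NNReal.coe_one, one_pow]
    ring
  have hsum : HasSum (fun N : ℕ => Real.exp (-1) * (ν.real Aᶜ ^ N / N.factorial))
      (Real.exp (-1) * Real.exp (ν.real Aᶜ)) := by
    have := NormedSpace.expSeries_div_hasSum_exp (𝔸 := ℝ) (ν.real Aᶜ)
    rw [← Real.exp_eq_exp_ℝ] at this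
    exact this.mul_left _
  rw [tsum_congr hterm, ← ENNReal.ofReal_tsum_of_nonneg (fun N => by positivity) hsum.summable,
    hsum.tsum_eq, ← Real.exp_add, probReal_compl_eq_one_sub hA]
  congr 2
  ring

/-- The void probability of the cloud. The set to be avoided meets only finitely many of the
sequences of points, so that a finite product of independent events is involved. -/
theorem real_poissonCloud_cloudAvoids (ν : ℕ → Measure Z) [∀ k, IsProbabilityMeasure (ν k)]
    {A : ℕ → Set Z} (hA : ∀ k, MeasurableSet (A k)) {K : ℕ} (hK : ∀ k, K ≤ k → A k = ∅) :
    (poissonCloud ν).real (cloudAvoids A)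
      = Real.exp (-∑ k ∈ Finset.range K, (ν k).real (A k)) := by
  have hset : cloudAvoids A = Set.pi (Finset.range K : Set ℕ)
      fun k => {x : ℕ × (ℕ → Z) | ∀ j < x.1, x.2 j ∉ A k} := by
    ext ω
    simp only [cloudAvoids, Set.mem_ofPred_eq, Set.mem_pi, Finset.coe_range, Set.mem_Iio]
    refine ⟨fun h k _ => h k, fun h k => ?_⟩
    rcases lt_or_ge k K with hk | hk
    · exact h k hk
    · simp [hK k hk]
  rw [hset, Measure.real, poissonCloud,
    Measure.infinitePi_pi _ (fun k _ => measurableSet_forall_lt_notMem (hA k)),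
    ENNReal.toReal_prod, ← Finset.sum_neg_distrib, Real.exp_sum]
  refine Finset.prod_congr rfl fun k _ => ?_
  rw [poisson_prod_forall_lt_notMem (ν k) (hA k), ENNReal.toReal_ofReal (Real.exp_nonneg _)]

end

/-! ### The limit process -/

/-- Lebesgue measure on the unit square `[k, k + 1) × (0, 1]`. -/
noncomputable def squareMeasure (k : ℕ) : Measure (ℝ × ℝ) :=
  volume.restrict (Set.Ico (k : ℝ) (k + 1) ×ˢ Set.Ioc (0 : ℝ) 1)

instance (k : ℕ) : IsProbabilityMeasure (squareMeasure k) := by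
  constructor
  rw [squareMeasure, Measure.restrict_apply_univ, Measure.volume_eq_prod, Measure.prod_prod,
    Real.volume_Ico, Real.volume_Ioc]
  simp

/-- The points `(w, v)` with `w ≥ k` for which the time `t` lies in the interval `[v / w, 1 / w)`,
during which two passengers share a bus. The condition `w ≥ k`, which holds almost surely for the
points of the `k`-th unit square, makes the intervals locally finite on the whole sample space. -/
def meetingSet (t : ℝ) (k : ℕ) : Set (ℝ × ℝ) :=
  {z | (k : ℝ) ≤ z.1 ∧ t ∈ Set.Ico (z.2 / z.1) (1 / z.1)}

open Classical in
/-- The limit process: it vanishes at time `t` if `t` lies in the interval `[v / w, 1 / w)` for some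
point `(w, v)` of the cloud. -/
noncomputable def limitIndicator (t : ℝ) (ω : ℕ → ℕ × (ℕ → ℝ × ℝ)) : ℝ :=
  if ω ∈ cloudAvoids (meetingSet t) then 1 else 0

theorem limitIndicator_eq_one_iff (t : ℝ) (ω : ℕ → ℕ × (ℕ → ℝ × ℝ)) :
    limitIndicator t ω = 1 ↔ ω ∈ cloudAvoids (meetingSet t) := by
  rw [limitIndicator]
  split_ifs with h <;> simp [h]

theorem limitIndicator_eq_zero_or_one (t : ℝ) (ω : ℕ → ℕ × (ℕ → ℝ × ℝ)) :
    limitIndicator t ω = 0 ∨ limitIndicator t ω = 1 := by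
  rw [limitIndicator]
  split_ifs <;> simp

theorem measurableSet_meetingSet (t : ℝ) (k : ℕ) : MeasurableSet (meetingSet t k) := by
  have : meetingSet t k = {z | (k : ℝ) ≤ z.1} ∩ ({z | z.2 / z.1 ≤ t} ∩ {z | t < 1 / z.1}) := rfl
  rw [this]
  refine (measurableSet_le measurable_const measurable_fst).inter
    ((measurableSet_le ?_ measurable_const).inter (measurableSet_lt measurable_const ?_))
  · exact measurable_snd.div measurable_fst
  · exact measurable_const.div measurable_fst

theorem measurable_limitIndicator (t : ℝ) : Measurable (limitIndicator t) := by
  classical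
  exact Measurable.ite (measurableSet_cloudAvoids (measurableSet_meetingSet t)) measurable_const
    measurable_const

theorem meetingSet_pos {t : ℝ} (ht : 0 < t) {k : ℕ} {z : ℝ × ℝ} (hz : z ∈ meetingSet t k) :
    0 < z.1 :=
  one_div_pos.mp (ht.trans hz.2.2)

theorem meetingSet_lt {t : ℝ} (ht : 0 < t) {k : ℕ} {z : ℝ × ℝ} (hz : z ∈ meetingSet t k) :
    (k : ℝ) < 1 / t :=
  hz.1.trans_lt ((lt_one_div ht (meetingSet_pos ht hz)).mp hz.2.2)

/-- A function is càdlàg at `t`. -/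
def IsCadlagAt (f : ℝ → ℝ) (t : ℝ) : Prop :=
  ContinuousWithinAt f (Set.Ici t) t ∧ ∃ l : ℝ, Tendsto f (𝓝[<] t) (𝓝 l)

theorem isCadlagAt_prod {ι : Type*} (s : Finset ι) {f : ι → ℝ → ℝ} {t : ℝ}
    (h : ∀ i ∈ s, IsCadlagAt (f i) t) : IsCadlagAt (fun x => ∏ i ∈ s, f i x) t := by
  refine ⟨tendsto_finsetProd s fun i hi => (h i hi).1, ?_⟩
  choose! l hl using fun i (hi : i ∈ s) => (h i hi).2
  exact ⟨∏ i ∈ s, l i, tendsto_finsetProd s hl⟩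

theorem IsCadlagAt.congr {f g : ℝ → ℝ} {t : ℝ} (h : IsCadlagAt f t) (hfg : f =ᶠ[𝓝 t] g) :
    IsCadlagAt g t :=
  ⟨h.1.congr_of_eventuallyEq (hfg.symm.filter_mono nhdsWithin_le_nhds) hfg.symm.self_of_nhds,
    h.2.imp fun _ hl => hl.congr' (hfg.filter_mono nhdsWithin_le_nhds)⟩

open Classical in
theorem isCadlagAt_Ico (a b x y t : ℝ) :
    IsCadlagAt (fun s => if s ∈ Set.Ico a b then x else y) t := by
  constructor
  · refine continuousWithinAt_const (b := if t ∈ Set.Ico a b then x else y)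
      |>.congr_of_eventuallyEq ?_ rfl
    rcases lt_or_ge t a with h1 | h1
    · filter_upwards [mem_nhdsWithin_of_mem_nhds (gt_mem_nhds h1)] with s hs
      rw [if_neg (fun h => absurd h.1 hs.not_ge), if_neg (fun h => absurd h.1 h1.not_ge)]
    rcases lt_or_ge t b with h2 | h2
    · filter_upwards [self_mem_nhdsWithin, mem_nhdsWithin_of_mem_nhds (gt_mem_nhds h2)]
        with s hs hs'
      rw [if_pos ⟨h1.trans hs, hs'⟩, if_pos ⟨h1, h2⟩]
    · filter_upwards [self_mem_nhdsWithin] with s hs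
      rw [if_neg (fun h => absurd h.2 (h2.trans hs).not_gt),
        if_neg (fun h => absurd h.2 h2.not_gt)]
  · rcases le_or_gt t a with h1 | h1
    · refine ⟨y, tendsto_const_nhds.congr' ?_⟩
      filter_upwards [self_mem_nhdsWithin] with s hs
      rw [if_neg (fun h => absurd h.1 (lt_of_lt_of_le hs h1).not_ge)]
    rcases le_or_gt t b with h2 | h2
    · refine ⟨x, tendsto_const_nhds.congr' ?_⟩
      filter_upwards [self_mem_nhdsWithin, mem_nhdsWithin_of_mem_nhds (lt_mem_nhds h1)]
        with s hs hs'
      rw [if_pos ⟨le_of_lt hs', lt_of_lt_of_le hs h2⟩]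
    · refine ⟨y, tendsto_const_nhds.congr' ?_⟩
      filter_upwards [mem_nhdsWithin_of_mem_nhds (lt_mem_nhds h2)] with s hs
      rw [if_neg (fun h => absurd h.2 (le_of_lt hs).not_gt)]

/-- Near `t` only times after `t / 2` matter, hence only the finitely many points that belong to
the first `K` unit squares, where `K ≥ 2 / t`. -/
theorem isCadlagOnPos_limitIndicator (ω : ℕ → ℕ × (ℕ → ℝ × ℝ)) :
    IsCadlagOnPos fun t => limitIndicator t ω := by
  classical
  intro t ht
  obtain ⟨K, hK⟩ := exists_nat_ge (1 / (t / 2))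
  have hprod : IsCadlagAt (fun s => ∏ k ∈ Finset.range K, ∏ j ∈ Finset.range (ω k).1,
      if s ∈ Set.Ico (((ω k).2 j).2 / ((ω k).2 j).1) (1 / ((ω k).2 j).1)
      then (if (k : ℝ) ≤ ((ω k).2 j).1 then 0 else 1) else 1) t :=
    isCadlagAt_prod _ fun k _ => isCadlagAt_prod _ fun j _ => isCadlagAt_Ico _ _ _ _ _
  refine hprod.congr ?_
  filter_upwards [lt_mem_nhds (half_lt_self ht)] with s hs
  have hs0 : 0 < s := (half_pos ht).trans hs
  rw [limitIndicator]
  split_ifs with h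
  · refine Finset.prod_eq_one fun k _ => Finset.prod_eq_one fun j hj => ?_
    split_ifs with h1 h2
    · exact absurd ⟨h2, h1⟩ (h k j (Finset.mem_range.mp hj))
    · rfl
    · rfl
  · simp only [cloudAvoids, Set.mem_ofPred_eq, not_forall, not_not] at h
    obtain ⟨k, j, hj, hz⟩ := h
    have hk : (k : ℝ) < K := (meetingSet_lt hs0 hz).trans_le
      ((one_div_le_one_div_of_le (half_pos ht) hs.le).trans hK)
    refine Finset.prod_eq_zero (Finset.mem_range.mpr (by exact_mod_cast hk))
      (Finset.prod_eq_zero (Finset.mem_range.mpr hj) ?_)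
    rw [if_pos hz.2, if_pos hz.1]

/-- The points `(w, v)` whose interval `[v / w, 1 / w)` starts after time `c` and contains `d`. -/
def newMeetingRegion (c d : ℝ) : Set (ℝ × ℝ) :=
  {z | z.1 ∈ Set.Ioo 0 (1 / d) ∧ z.2 ∈ Set.Ioc (c * z.1) (d * z.1)}

theorem measurableSet_newMeetingRegion (c d : ℝ) : MeasurableSet (newMeetingRegion c d) := by
  refine (measurable_fst measurableSet_Ioo).inter
    ((measurableSet_lt ?_ measurable_snd).inter (measurableSet_le measurable_snd ?_))
  · exact measurable_fst.const_mul c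
  · exact measurable_fst.const_mul d

theorem real_volume_newMeetingRegion {c d : ℝ} (hc : 0 ≤ c) (hcd : c < d) :
    volume.real (newMeetingRegion c d) = (d - c) / (2 * d ^ 2) := by
  have hd : 0 < d := hc.trans_lt hcd
  have hsec : ∀ w : ℝ, volume (Prod.mk w ⁻¹' newMeetingRegion c d)
      = (Set.Ioo 0 (1 / d)).indicator (fun w => ENNReal.ofReal ((d - c) * w)) w := by
    intro w
    by_cases hw : w ∈ Set.Ioo 0 (1 / d)
    · have : Prod.mk w ⁻¹' newMeetingRegion c d = Set.Ioc (c * w) (d * w) := by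
        ext v
        simp only [newMeetingRegion, Set.mem_preimage, Set.mem_ofPred_eq, hw, true_and]
      rw [this, Real.volume_Ioc, Set.indicator_of_mem hw, sub_mul]
    · have : Prod.mk w ⁻¹' newMeetingRegion c d = ∅ := by
        ext v
        simp only [newMeetingRegion, Set.mem_preimage, Set.mem_ofPred_eq, hw, false_and,
          Set.mem_empty_iff_false]
      rw [this, measure_empty, Set.indicator_of_notMem hw]
  have hint : ∫ w in Set.Ioo 0 (1 / d), (d - c) * w = (d - c) / (2 * d ^ 2) := by
    rw [← integral_Ioc_eq_integral_Ioo, ← intervalIntegral.integral_of_le (by positivity),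
      intervalIntegral.integral_const_mul, integral_id]
    field_simp
    ring
  rw [Measure.real, Measure.volume_eq_prod,
    Measure.prod_apply (measurableSet_newMeetingRegion c d), lintegral_congr hsec,
    lintegral_indicator measurableSet_Ioo, ← ofReal_integral_eq_lintegral_ofReal, hint,
    ENNReal.toReal_ofReal (div_nonneg (by linarith) (by positivity))]
  · exact (Continuous.integrableOn_Icc (by fun_prop)).mono_set Set.Ioo_subset_Icc_self
  · refine (ae_restrict_iff' measurableSet_Ioo).mpr (.of_forall fun w hw => ?_)
    exact mul_nonneg (by linarith) hw.1.le

/-- The points that make the limit process vanish at some time of `F`. -/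
def meetingUnion (F : Finset ℝ) (k : ℕ) : Set (ℝ × ℝ) := ⋃ t ∈ F, meetingSet t k

theorem measurableSet_meetingUnion (F : Finset ℝ) (k : ℕ) : MeasurableSet (meetingUnion F k) :=
  Finset.measurableSet_biUnion _ fun t _ => measurableSet_meetingSet t k

theorem meetingSet_diff_inter_square {F : Finset ℝ} {c d : ℝ} (hF : ∀ t ∈ F, 0 < t)
    (hc : IsLastTime F c) (hcd : c < d) (k : ℕ) :
    (meetingSet d k \ meetingUnion F k) ∩ (Set.Ico (k : ℝ) (k + 1) ×ˢ Set.Ioc (0 : ℝ) 1)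
      = newMeetingRegion c d ∩ Prod.fst ⁻¹' (Set.Ico (k : ℝ) (k + 1)) := by
  have hc0 := hc.nonneg hF
  have hd : 0 < d := hc0.trans_lt hcd
  ext ⟨w, v⟩
  constructor
  · rintro ⟨⟨hz, hzF⟩, hw, hv⟩
    have hw0 : 0 < w := meetingSet_pos hd hz
    have hwd : w < 1 / d := (lt_one_div hd hw0).mp hz.2.2
    have hdv : v ≤ d * w := (div_le_iff₀ hw0).mp hz.2.1
    refine ⟨⟨⟨hw0, hwd⟩, ?_, hdv⟩, hw⟩
    rcases hc with ⟨-, rfl⟩ | ⟨hcF, -⟩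
    · simpa using hv.1
    · by_contra hlt
      refine hzF (Set.mem_biUnion hcF ⟨hz.1, (div_le_iff₀ hw0).mpr (not_lt.mp hlt), ?_⟩)
      exact hcd.trans hz.2.2
  · rintro ⟨⟨⟨hw0, hwd⟩, hcv, hdv⟩, hw⟩
    simp only at hw0 hwd hcv hdv
    have hdw : d < 1 / w := (lt_one_div hw0 hd).mp hwd
    refine ⟨⟨⟨hw.1, (div_le_iff₀ hw0).mpr hdv, hdw⟩, fun hzF => ?_⟩, hw,
      lt_of_le_of_lt (by positivity) hcv, hdv.trans ((lt_div_iff₀ hw0).mp hdw).le⟩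
    obtain ⟨t, ht, hz⟩ := Set.mem_iUnion₂.mp hzF
    have htc : t ≤ c := by
      rcases hc with ⟨rfl, -⟩ | ⟨-, hc⟩
      · simp at ht
      · exact hc t ht
    have h1 : v ≤ t * w := (div_le_iff₀ hw0).mp hz.2.1
    have h2 : t * w ≤ c * w := by gcongr
    exact absurd hcv (h1.trans h2).not_gt

theorem sum_squareMeasure_diff {F : Finset ℝ} {c d : ℝ} (hF : ∀ t ∈ F, 0 < t)
    (hc : IsLastTime F c) (hcd : c < d) {K : ℕ} (hK : 1 / d ≤ K) :
    ∑ k ∈ Finset.range K, (squareMeasure k).real (meetingSet d k \ meetingUnion F k)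
      = (d - c) / (2 * d ^ 2) := by
  have hc0 := hc.nonneg hF
  have hd : 0 < d := hc0.trans_lt hcd
  have hterm : ∀ k ∈ Finset.range K,
      (squareMeasure k).real (meetingSet d k \ meetingUnion F k)
      = volume.real (newMeetingRegion c d ∩ Prod.fst ⁻¹' (Set.Ico (k : ℝ) (k + 1))) := by
    intro k _
    rw [squareMeasure, measureReal_restrict_apply
      ((measurableSet_meetingSet d k).diff (measurableSet_meetingUnion F k)),
      meetingSet_diff_inter_square hF hc hcd]
  have hunion : newMeetingRegion c d
      = ⋃ k ∈ Finset.range K, newMeetingRegion c d ∩ Prod.fst ⁻¹' (Set.Ico (k : ℝ) (k + 1)) := by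
    ext z
    simp only [Set.mem_iUnion, Set.mem_inter_iff, exists_prop, Finset.mem_range]
    refine ⟨fun hz => ⟨⌊z.1⌋₊, ?_, hz, Nat.floor_le hz.1.1.le, Nat.lt_floor_add_one _⟩,
      fun ⟨_, _, hz, _⟩ => hz⟩
    exact (Nat.floor_lt hz.1.1.le).mpr (hz.1.2.trans_le hK)
  have hfin : volume (newMeetingRegion c d) ≠ ⊤ := by
    intro h
    have := real_volume_newMeetingRegion hc0 hcd
    rw [Measure.real, h, ENNReal.toReal_top] at this
    have h2 : 0 < (d - c) / (2 * d ^ 2) := div_pos (by linarith) (by positivity)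
    linarith
  rw [Finset.sum_congr rfl hterm, ← measureReal_biUnion_finset, ← hunion,
    real_volume_newMeetingRegion hc0 hcd]
  · intro k _ l _ hkl
    refine Set.disjoint_left.mpr ?_
    rintro z ⟨hz, h1⟩ ⟨-, h2⟩
    apply hkl
    have e1 := (Nat.floor_eq_iff hz.1.1.le).mpr h1
    have e2 := (Nat.floor_eq_iff hz.1.1.le).mpr h2
    exact e1.symm.trans e2
  · exact fun k _ => (measurableSet_newMeetingRegion c d).inter (measurable_fst measurableSet_Ico)

/-- The event that the limit process equals `1` at all the times in `F`. -/
def limitDetachedAt (F : Finset ℝ) : Set (ℕ → ℕ × (ℕ → ℝ × ℝ)) :=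
  {ω | ∀ t ∈ F, limitIndicator t ω = 1}

theorem limitDetachedAt_eq_cloudAvoids (F : Finset ℝ) :
    limitDetachedAt F = cloudAvoids (meetingUnion F) := by
  ext ω
  simp only [limitDetachedAt, limitIndicator_eq_one_iff, cloudAvoids, meetingUnion,
    Set.mem_ofPred_eq, Set.mem_iUnion, not_exists]
  exact ⟨fun h k j hj t ht => h t ht k j hj, fun h t ht k j hj => h k j hj t ht⟩

/-- A new largest time `d` contributes to the exponent the area of the points whose interval
contains `d` but no time of `F`. -/
theorem real_limitDetachedAt_insert {F : Finset ℝ} {c d : ℝ} (hF : ∀ t ∈ F, 0 < t)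
    (hc : IsLastTime F c) (hcd : c < d) :
    (poissonCloud squareMeasure).real (limitDetachedAt (insert d F))
      = (poissonCloud squareMeasure).real (limitDetachedAt F)
        * Real.exp (-((d - c) / (2 * d ^ 2))) := by
  have hd : 0 < d := (hc.nonneg hF).trans_lt hcd
  have hF' : ∀ t ∈ insert d F, 0 < t := Finset.forall_mem_insert _ _ _ |>.mpr ⟨hd, hF⟩
  obtain ⟨M, hM⟩ := ((insert d F).image fun t => 1 / t).exists_le
  obtain ⟨K, hMK⟩ := exists_nat_ge M
  have hK : ∀ t ∈ insert d F, 1 / t ≤ K := fun t ht =>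
    (hM _ (Finset.mem_image_of_mem _ ht)).trans hMK
  have hempty : ∀ k, K ≤ k → meetingUnion (insert d F) k = ∅ := by
    intro k hk
    refine Set.eq_empty_of_forall_notMem fun z hz => ?_
    obtain ⟨t, ht, hz⟩ := Set.mem_iUnion₂.mp hz
    have h1 := (meetingSet_lt (hF' t ht) hz).trans_le (hK t ht)
    exact absurd (Nat.cast_lt.mp h1) hk.not_gt
  have hsub : ∀ k, meetingUnion F k ⊆ meetingUnion (insert d F) k := fun k =>
    Set.biUnion_subset_biUnion_left fun t ht => Finset.mem_insert_of_mem ht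
  have hempty' : ∀ k, K ≤ k → meetingUnion F k = ∅ := fun k hk =>
    Set.subset_empty_iff.mp (hempty k hk ▸ hsub k)
  have hsplit : ∀ k, (squareMeasure k).real (meetingUnion (insert d F) k)
      = (squareMeasure k).real (meetingUnion F k)
        + (squareMeasure k).real (meetingSet d k \ meetingUnion F k) := by
    intro k
    rw [← measureReal_union Set.disjoint_sdiff_right
      ((measurableSet_meetingSet d k).diff (measurableSet_meetingUnion F k)),
      Set.union_sdiff_self, Set.union_comm, meetingUnion, Finset.set_biUnion_insert]
    rfl
  rw [limitDetachedAt_eq_cloudAvoids, limitDetachedAt_eq_cloudAvoids,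
    real_poissonCloud_cloudAvoids _ (measurableSet_meetingUnion _) hempty,
    real_poissonCloud_cloudAvoids _ (measurableSet_meetingUnion _) hempty',
    Finset.sum_congr rfl fun k _ => hsplit k, Finset.sum_add_distrib,
    sum_squareMeasure_diff hF hc hcd (hK d (Finset.mem_insert_self d F)), neg_add, Real.exp_add]

/-! ### Convergence in distribution of `{0, 1}`-valued vectors -/

/-- On `{0, 1}`-valued vectors every function agrees with a multilinear polynomial. -/
theorem exists_eq_sum_prod_of_zero_one {ι : Type*} [Fintype ι] [DecidableEq ι] (f : (ι → ℝ) → ℝ) :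
    ∃ a : Finset ι → ℝ, ∀ x : ι → ℝ, (∀ j, x j = 0 ∨ x j = 1) →
      f x = ∑ S, a S * ∏ j ∈ S, x j := by
  refine ⟨fun S => ∑ T : Finset ι, f (fun j => if j ∈ T then 1 else 0) *
    ((∏ j ∈ S, if j ∈ T then (1 : ℝ) else -1) *
      ∏ j ∈ Finset.univ \ S, if j ∈ T then (0 : ℝ) else 1), fun x hx => ?_⟩
  -- The product is the indicator of `x` being the indicator vector of `T`.
  have hprod : ∀ T : Finset ι, ∏ j, ((if j ∈ T then (1 : ℝ) else -1) * x j
      + if j ∈ T then (0 : ℝ) else 1) =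
      if T = Finset.univ.filter (fun j => x j = 1) then 1 else 0 := by
    intro T
    split_ifs with hT
    · refine Finset.prod_eq_one fun j _ => ?_
      rcases hx j with h | h <;> simp [hT, h]
    · obtain ⟨j, hj⟩ : ∃ j, ¬ (j ∈ T ↔ x j = 1) := by
        by_contra! hall
        exact hT (by ext j; simp [hall j])
      refine Finset.prod_eq_zero (Finset.mem_univ j) ?_
      rcases hx j with h | h <;> by_cases hjT : j ∈ T <;> simp_all
  have hx' : x = fun j => if j ∈ Finset.univ.filter (fun j => x j = 1) then 1 else 0 := by
    funext j
    rcases hx j with h | h <;> simp [h]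
  calc f x = ∑ T : Finset ι, f (fun j => if j ∈ T then 1 else 0) *
        (if T = Finset.univ.filter (fun j => x j = 1) then 1 else 0) := by
          simp only [mul_ite, mul_one, mul_zero, Finset.sum_ite_eq', Finset.mem_univ, if_true]
          exact congrArg f hx'
    _ = ∑ T : Finset ι, ∑ S : Finset ι, f (fun j => if j ∈ T then 1 else 0) *
        ((∏ j ∈ S, if j ∈ T then (1 : ℝ) else -1) *
          ∏ j ∈ Finset.univ \ S, if j ∈ T then (0 : ℝ) else 1) * ∏ j ∈ S, x j := by
          refine Finset.sum_congr rfl fun T _ => ?_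
          rw [← hprod T, Finset.prod_add, Finset.powerset_univ, Finset.mul_sum]
          refine Finset.sum_congr rfl fun S _ => ?_
          rw [Finset.prod_mul_distrib]
          ring
    _ = _ := by
          rw [Finset.sum_comm]
          simp only [Finset.sum_mul]

theorem integral_prod_of_zero_one {Ω ι : Type*} [MeasurableSpace Ω] {P : Measure Ω}
    {X : Ω → ι → ℝ} (hX : ∀ j, Measurable fun ω => X ω j)
    (h01 : ∀ ω j, X ω j = 0 ∨ X ω j = 1) (S : Finset ι) :
    ∫ ω, ∏ j ∈ S, X ω j ∂P = P.real {ω | ∀ j ∈ S, X ω j = 1} := by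
  have hm : MeasurableSet {ω | ∀ j ∈ S, X ω j = 1} := by
    have : {ω | ∀ j ∈ S, X ω j = 1} = ⋂ j ∈ S, {ω | X ω j = 1} := by ext; simp
    rw [this]
    exact Finset.measurableSet_biInter _ fun j _ => hX j (MeasurableSet.singleton _)
  rw [← integral_indicator_one hm]
  refine integral_congr_ae (.of_forall fun ω => ?_)
  by_cases h : ω ∈ {ω | ∀ j ∈ S, X ω j = 1}
  · rw [Set.indicator_of_mem h]
    exact Finset.prod_eq_one h
  · rw [Set.indicator_of_notMem h]
    simp only [Set.mem_ofPred_eq, not_forall] at h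
    obtain ⟨j, hj, h⟩ := h
    exact Finset.prod_eq_zero hj ((h01 ω j).resolve_right h)

theorem integral_map_of_zero_one {Ω ι : Type*} [Fintype ι] [MeasurableSpace Ω]
    {P : Measure Ω} [IsProbabilityMeasure P] {X : Ω → ι → ℝ}
    (hX : ∀ j, Measurable fun ω => X ω j) (h01 : ∀ ω j, X ω j = 0 ∨ X ω j = 1)
    {f : (ι → ℝ) → ℝ} (hf : Continuous f) {a : Finset ι → ℝ}
    (ha : ∀ x : ι → ℝ, (∀ j, x j = 0 ∨ x j = 1) → f x = ∑ S, a S * ∏ j ∈ S, x j) :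
    ∫ x, f x ∂(P.map X) = ∑ S, a S * P.real {ω | ∀ j ∈ S, X ω j = 1} := by
  rw [integral_map (measurable_pi_iff.mpr hX).aemeasurable hf.aestronglyMeasurable]
  simp only [fun ω => ha (X ω) (h01 ω)]
  rw [integral_finsetSum]
  · exact Finset.sum_congr rfl fun S _ => by
      rw [integral_const_mul, integral_prod_of_zero_one hX h01]
  · intro S _
    refine Integrable.const_mul (Integrable.of_bound (C := 1)
      (Finset.measurable_prod S fun j _ => hX j).aestronglyMeasurable
      (.of_forall fun ω => ?_)) _
    rw [Real.norm_eq_abs, Finset.abs_prod]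
    refine Finset.prod_le_one (fun j _ => abs_nonneg _) fun j _ => ?_
    rcases h01 ω j with h | h <;> simp [h]

/-- The law of a `{0, 1}`-valued vector is determined by the probabilities that the coordinates in
a given set are all `1`, so these determine convergence in distribution. -/
theorem tendstoInDistribution_of_zero_one {ι : Type*} [Fintype ι] {Ω : ℕ → Type*} {Ω' : Type*}
    [∀ n, MeasurableSpace (Ω n)] [MeasurableSpace Ω'] {P : ∀ n, Measure (Ω n)}
    [∀ n, IsProbabilityMeasure (P n)] {Q : Measure Ω'} [IsProbabilityMeasure Q]
    {X : ∀ n, Ω n → ι → ℝ} {Y : Ω' → ι → ℝ}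
    (hX : ∀ n j, Measurable fun ω => X n ω j) (hY : ∀ j, Measurable fun ω => Y ω j)
    (hX01 : ∀ n ω j, X n ω j = 0 ∨ X n ω j = 1) (hY01 : ∀ ω j, Y ω j = 0 ∨ Y ω j = 1)
    (h : ∀ S : Finset ι, Tendsto (fun n => (P n).real {ω | ∀ j ∈ S, X n ω j = 1}) atTop
      (𝓝 (Q.real {ω | ∀ j ∈ S, Y ω j = 1}))) :
    TendstoInDistribution X atTop Y P Q := by
  classical
  refine ⟨fun n => (measurable_pi_iff.mpr (hX n)).aemeasurable,
    (measurable_pi_iff.mpr hY).aemeasurable, ?_⟩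
  refine ProbabilityMeasure.tendsto_iff_forall_integral_tendsto.mpr fun f => ?_
  obtain ⟨a, ha⟩ := exists_eq_sum_prod_of_zero_one (fun x => f x)
  have hlim := tendsto_finsetSum (Finset.univ : Finset (Finset ι)) fun S _ => (h S).const_mul (a S)
  rw [← integral_map_of_zero_one hY hY01 f.continuous ha] at hlim
  exact hlim.congr fun n => (integral_map_of_zero_one (hX n) (hX01 n) f.continuous ha).symm

/-! ### Convergence of the detachment probabilities and the transitions -/

theorem tendsto_real_detachedAt {Ω : ℕ → Type*} [∀ n, MeasurableSpace (Ω n)]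
    {P : ∀ n, Measure (Ω n)} [∀ n, IsProbabilityMeasure (P n)] {B : ∀ n, ℕ → Ω n → Fin n → ℕ}
    (h : ∀ n, IsDetachmentProcess (P n) n (B n)) (F : Finset ℝ) (hF : ∀ t ∈ F, 0 < t) :
    Tendsto (fun n => (P n).real (detachedAt (B n) F)) atTop
      (𝓝 ((poissonCloud squareMeasure).real (limitDetachedAt F))) := by
  refine induction_on_lastTime (p := fun F => Tendsto (fun n => (P n).real (detachedAt (B n) F))
    atTop (𝓝 ((poissonCloud squareMeasure).real (limitDetachedAt F)))) F hF ?_ ?_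
  · simp [detachedAt, limitDetachedAt]
  · intro F c d hF hc hcd ih
    simp only [fun n => (h n).real_detachedAt_insert hc hcd]
    rw [real_limitDetachedAt_insert hF hc hcd]
    exact ih.mul (tendsto_detachmentTransition_observationTime hF hc hcd)

theorem real_limitDetachedAt_singleton {c : ℝ} (hc : 0 < c) :
    (poissonCloud squareMeasure).real (limitDetachedAt {c}) = Real.exp (-(1 / (2 * c))) := by
  have := real_limitDetachedAt_insert (F := ∅) (by simp) (Or.inl ⟨rfl, rfl⟩) hc
  rw [insert_empty_eq] at this
  rw [this]
  have h1 : limitDetachedAt ∅ = Set.univ := by simp [limitDetachedAt]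
  rw [h1, probReal_univ, one_mul]
  congr 2
  field_simp
  ring

theorem real_limitDetachedAt_pair {c d : ℝ} (hc : 0 < c) (hcd : c < d) :
    (poissonCloud squareMeasure).real (limitDetachedAt {d, c})
      = Real.exp (-(1 / (2 * c))) * Real.exp (-((d - c) / (2 * d ^ 2))) := by
  rw [real_limitDetachedAt_insert (by simpa using hc) (isLastTime_singleton c) hcd,
    real_limitDetachedAt_singleton hc]

section

variable {Ω : Type*} [MeasurableSpace Ω] (P : Measure Ω)

theorem cond_real_eq_div {A : Set Ω} (hA : MeasurableSet A) (C : Set Ω) :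
    (P[|A]).real C = P.real (A ∩ C) / P.real A := by
  rw [Measure.real, cond_apply hA, ENNReal.toReal_mul, ENNReal.toReal_inv, div_eq_inv_mul]
  rfl

theorem cond_real_setOf_one {X Y : Ω → ℝ} (hX : Measurable X) :
    (P[|{ω | X ω = 1}]).real {ω | Y ω = 1}
      = P.real {ω | Y ω = 1 ∧ X ω = 1} / P.real {ω | X ω = 1} := by
  rw [cond_real_eq_div P (A := {ω | X ω = 1}) (hX (MeasurableSet.singleton 1))]
  congr 2
  ext ω
  exact and_comm

theorem cond_real_setOf_zero [IsProbabilityMeasure P] {X Y : Ω → ℝ} (hX : Measurable X)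
    (hX01 : ∀ ω, X ω = 0 ∨ X ω = 1) :
    (P[|{ω | X ω = 0}]).real {ω | Y ω = 1}
      = (P.real {ω | Y ω = 1} - P.real {ω | Y ω = 1 ∧ X ω = 1}) / (1 - P.real {ω | X ω = 1}) := by
  have hm : MeasurableSet {ω | X ω = 1} := hX (MeasurableSet.singleton 1)
  have h0 : {ω | X ω = 0} = {ω | X ω = 1}ᶜ := by
    ext ω
    rcases hX01 ω with h | h <;> simp [h]
  rw [cond_real_eq_div P (A := {ω | X ω = 0}) (hX (MeasurableSet.singleton 0)), h0,
    probReal_compl_eq_one_sub hm]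
  congr 1
  have h1 := measureReal_inter_add_sdiff (μ := P) (s := {ω | Y ω = 1}) hm
  have h2 : {ω | X ω = 1}ᶜ ∩ {ω | Y ω = 1} = {ω | Y ω = 1} \ {ω | X ω = 1} := by
    rw [Set.sdiff_eq, Set.inter_comm]
  have h3 : {ω | Y ω = 1} ∩ {ω | X ω = 1} = {ω | Y ω = 1 ∧ X ω = 1} := rfl
  rw [h2, ← h1, h3]
  ring

end

theorem detachedAt_singleton {Ω : Type*} {n : ℕ} (B : ℕ → Ω → Fin n → ℕ) (c : ℝ) :
    detachedAt B {c} = {ω | detachmentIndicator B c ω = 1} := by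
  simp [detachedAt]

theorem detachedAt_pair {Ω : Type*} {n : ℕ} (B : ℕ → Ω → Fin n → ℕ) (c d : ℝ) :
    detachedAt B {d, c} =
      {ω | detachmentIndicator B d ω = 1 ∧ detachmentIndicator B c ω = 1} := by
  simp [detachedAt]

theorem limitDetachedAt_singleton (c : ℝ) :
    limitDetachedAt {c} = {ω | limitIndicator c ω = 1} := by
  simp [limitDetachedAt]

theorem limitDetachedAt_pair (c d : ℝ) :
    limitDetachedAt {d, c} = {ω | limitIndicator d ω = 1 ∧ limitIndicator c ω = 1} := by
  simp [limitDetachedAt]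

theorem limit_cond_one {c d : ℝ} (hc : 0 < c) (hcd : c < d) :
    ((poissonCloud squareMeasure)[|{ω | limitIndicator c ω = 1}]).real
      {ω | limitIndicator d ω = 1} = Real.exp (-((d - c) / (2 * d ^ 2))) := by
  rw [cond_real_setOf_one _ (measurable_limitIndicator c), ← limitDetachedAt_pair,
    ← limitDetachedAt_singleton, real_limitDetachedAt_pair hc hcd,
    real_limitDetachedAt_singleton hc, mul_div_cancel_left₀ _ (Real.exp_ne_zero _)]

theorem limit_cond_zero {c d : ℝ} (hc : 0 < c) (hcd : c < d) :
    ((poissonCloud squareMeasure)[|{ω | limitIndicator c ω = 0}]).real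
      {ω | limitIndicator d ω = 1} =
      (Real.exp (-(1 / (2 * d))) - Real.exp (-(1 / (2 * c)) - (d - c) / (2 * d ^ 2))) /
        (1 - Real.exp (-(1 / (2 * c)))) := by
  rw [cond_real_setOf_zero _ (measurable_limitIndicator c) (limitIndicator_eq_zero_or_one c),
    ← limitDetachedAt_pair, ← limitDetachedAt_singleton, ← limitDetachedAt_singleton,
    real_limitDetachedAt_pair hc hcd, real_limitDetachedAt_singleton hc,
    real_limitDetachedAt_singleton (hc.trans hcd), ← Real.exp_add, sub_eq_add_neg (-(1 / (2 * c)))]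

theorem mainTheorem4 :
    ∃ (Ω' : Type) (_ : MeasurableSpace Ω') (Q : Measure Ω') (_ : IsProbabilityMeasure Q)
      (Y : ℝ → Ω' → ℝ),
      -- the limit process is a `{0, 1}`-valued process with càdlàg paths on `(0, ∞)`
      (∀ t, 0 < t → Measurable (Y t)) ∧
      (∀ t ω, 0 < t → Y t ω = 0 ∨ Y t ω = 1) ∧
      (∀ ω, IsCadlagOnPos fun t => Y t ω) ∧
      -- its one-time probabilities and two-time transitions
      (∀ c, 0 < c → Q.real {ω | Y c ω = 1} = Real.exp (-(1 / (2 * c)))) ∧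
      (∀ c d, 0 < c → c < d →
        (Q[|{ω | Y c ω = 1}]).real {ω | Y d ω = 1} = Real.exp (-((d - c) / (2 * d ^ 2)))) ∧
      (∀ c d, 0 < c → c < d →
        (Q[|{ω | Y c ω = 0}]).real {ω | Y d ω = 1} =
          (Real.exp (-(1 / (2 * d))) - Real.exp (-(1 / (2 * c)) - (d - c) / (2 * d ^ 2))) /
            (1 - Real.exp (-(1 / (2 * c))))) ∧
      -- for every realization of the `n`-detachment processes, `n = 0, 1, 2, …`
      ∀ (Ω : ℕ → Type u) [∀ n, MeasurableSpace (Ω n)] (P : ∀ n, Measure (Ω n))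
        [∀ n, IsProbabilityMeasure (P n)] (B : ∀ n, ℕ → Ω n → Fin n → ℕ),
        (∀ n, IsDetachmentProcess (P n) n (B n)) →
        -- the rescaled indicator processes have càdlàg paths
        (∀ n ω, IsCadlagOnPos fun t => detachmentIndicator (B n) t ω) ∧
        -- and they converge to `Y` in finite-dimensional distributions
        (∀ (m : ℕ) (t : Fin m → ℝ), (∀ j, 0 < t j) →
          TendstoInDistribution
            (fun (n : ℕ) (ω : Ω n) (j : Fin m) => detachmentIndicator (B n) (t j) ω) atTop
            (fun (ω : Ω') (j : Fin m) => Y (t j) ω) P Q) ∧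
        -- and so do their two-time transition probabilities
        (∀ c d, 0 < c → c < d →
          Tendsto (fun n => ((P n)[|{ω | detachmentIndicator (B n) c ω = 1}]).real
              {ω | detachmentIndicator (B n) d ω = 1}) atTop
            (𝓝 (Real.exp (-((d - c) / (2 * d ^ 2)))))) ∧
        (∀ c d, 0 < c → c < d →
          Tendsto (fun n => ((P n)[|{ω | detachmentIndicator (B n) c ω = 0}]).real
              {ω | detachmentIndicator (B n) d ω = 1}) atTop
            (𝓝 ((Real.exp (-(1 / (2 * d))) - Real.exp (-(1 / (2 * c)) - (d - c) / (2 * d ^ 2))) /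
              (1 - Real.exp (-(1 / (2 * c))))))) := by
  refine ⟨_, inferInstance, poissonCloud squareMeasure, inferInstance, limitIndicator,
    fun t _ => measurable_limitIndicator t, fun t ω _ => limitIndicator_eq_zero_or_one t ω,
    isCadlagOnPos_limitIndicator, fun c hc => ?_, fun c d => limit_cond_one,
    fun c d => limit_cond_zero, ?_⟩
  · rw [← limitDetachedAt_singleton, real_limitDetachedAt_singleton hc]
  intro Ω _ P _ B h
  have hsing : ∀ c, 0 < c → Tendsto (fun n => (P n).real
      {ω | detachmentIndicator (B n) c ω = 1}) atTop (𝓝 ((poissonCloud squareMeasure).real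
      {ω | limitIndicator c ω = 1})) := fun c hc => by
    simpa only [detachedAt_singleton, limitDetachedAt_singleton]
      using tendsto_real_detachedAt h {c} (by simpa using hc)
  have hpair : ∀ c d, 0 < c → c < d → Tendsto (fun n => (P n).real
      {ω | detachmentIndicator (B n) d ω = 1 ∧ detachmentIndicator (B n) c ω = 1}) atTop
      (𝓝 ((poissonCloud squareMeasure).real
        {ω | limitIndicator d ω = 1 ∧ limitIndicator c ω = 1})) := fun c d hc hcd => by
    simpa only [detachedAt_pair, limitDetachedAt_pair]
      using tendsto_real_detachedAt h {d, c} (by simpa using ⟨hc.trans hcd, hc⟩)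
  have hval : ∀ c, 0 < c → (poissonCloud squareMeasure).real {ω | limitIndicator c ω = 1}
      = Real.exp (-(1 / (2 * c))) := fun c hc => by
    rw [← limitDetachedAt_singleton, real_limitDetachedAt_singleton hc]
  refine ⟨fun n ω => isCadlagOnPos_detachmentIndicator (B n) ω, fun m t ht => ?_,
    fun c d hc hcd => ?_, fun c d hc hcd => ?_⟩
  · refine tendstoInDistribution_of_zero_one
      (fun n j => (h n).measurable_detachmentIndicator (t j))
      (fun j => measurable_limitIndicator (t j))
      (fun n ω j => detachmentIndicator_eq_zero_or_one (B n) (t j) ω)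
      (fun ω j => limitIndicator_eq_zero_or_one (t j) ω) fun S => ?_
    simpa only [detachedAt, limitDetachedAt, Finset.forall_mem_image]
      using tendsto_real_detachedAt h (S.image t) (by simpa using fun j _ => ht j)
  · rw [← limit_cond_one hc hcd, cond_real_setOf_one _ (measurable_limitIndicator c)]
    simp only [fun n => cond_real_setOf_one (P n) (Y := detachmentIndicator (B n) d)
      ((h n).measurable_detachmentIndicator c)]
    refine (hpair c d hc hcd).div (hsing c hc) ?_
    rw [hval c hc]
    exact Real.exp_ne_zero _
  · rw [← limit_cond_zero hc hcd, cond_real_setOf_zero _ (measurable_limitIndicator c)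
      (limitIndicator_eq_zero_or_one c)]
    simp only [fun n => cond_real_setOf_zero (P n) (Y := detachmentIndicator (B n) d)
      ((h n).measurable_detachmentIndicator c) (detachmentIndicator_eq_zero_or_one (B n) c)]
    refine ((hsing d (hc.trans hcd)).sub (hpair c d hc hcd)).div
      ((hsing c hc).const_sub 1) ?_
    rw [hval c hc, sub_ne_zero, ne_comm, Ne, Real.exp_eq_one_iff]
    have : 0 < 1 / (2 * c) := by positivity
    linarith
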